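/- Let $F=\mathbb{Q}(t)$ and let $\Lambda_F$ be the ring of symmetric functions in $x_1,x_2,\dots$ over $F$, with power sums $p_n=\sum_i x_i^n$ and $p_\rho=p_{\rho_1}p_{\rho_2}\cdots$ for a partition $\rho$. Write $|\rho|$ for the weight, $l(\rho)$ for the number of nonzero parts and $m_i(\rho)$ for the multiplicity of $i$ in $\rho$, and let $\tau\cup\rho$ be the partition whose parts are those of $\tau$ together with those of $\rho$. Put $$z_\rho=\prod_{i\ge1} i^{m_i(\rho)}m_i(\rho)!,\qquad z_\rho(t)=\frac{z_\rho}{\prod_{i\ge1}(1-t^{\rho_i})},\qquad q_a=\sum_{\rho\vdash a}\frac{1}{z_\rho(t)}\,p_\rho\quad(a\ge 0),\qquad q_a=0\quad(a<0).$$ For a partition $\lambda=(\lambda_1\ge\dots\ge\lambda_l>0)$ the Hall--Littlewood functions are $$Q_\lambda(t)=\prod_{i<j}\frac{1-R_{ij}}{1-tR_{ij}}\;q_{\lambda_1}\cdots q_{\lambda_l},\qquad P_\lambda(t)=b_\lambda(t)^{-1}Q_\lambda(t),\qquad b_\lambda(t)=\prod_{i\ge1}\prod_{j=1}^{m_i(\lambda)}(1-t^j),$$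 where the raising operator $R_{ij}$ adds $1$ to the $i$-th index and subtracts $1$ from the $j$-th index. For every $n\ge 0$ there are unique $X^\lambda_\mu(t)\in F$ ($\lambda,\mu\vdash n$) with $p_\mu=\sum_{\lambda\vdash n}X^\lambda_\mu(t)P_\lambda(t)$ for all $\mu\vdash n$. A subpartition $\tau\lhd\mu$ of $\mu=(\mu_1,\dots,\mu_l)$ is $\tau=(\mu_{i_1},\dots,\mu_{i_s})$ with $1\le i_1<\dots<i_s\le l$; sums over $\tau\lhd\mu$ run over all $2^{l}$ index sets $\{i_1,\dots,i_s\}$ (including the empty one and the full one), so that equal $\tau$ coming from different index sets are counted separately. **Theorem.** For every $n\ge 0$ and every partition $\mu\vdash n$: (1) for every integer $k$ with $0\le k\le n-k$, $$X^{(n-k,k)}_{\mu}(t)=\sum_{\substack{\tau\lhd\mu\\ |\tau|\le k}}\ \sum_{\rho\vdash k-|\tau|}\frac{(-1)^{l(\rho)}}{z_\rho(t)};$$ (2) for every integer $k$ with $1\le k\le n$, $$X^{(k,1^{n-k})}_{\mu}(t)=\frac{\prod_{i=1}^{n-k}(t^i-1)}{\prod_{j\ge1}(t^{\mu_j}-1)}\sum_{\substack{\tau\lhd\mu\\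 |\tau|\ge k}}\ \prod_{j\ge1}(t^{\tau_j}-1);$$ (3) for all integers $k_1\ge k_2\ge k_3\ge0$ with $k_1+k_2+k_3=n$, $$X^{(k_1,k_2,k_3)}_{\mu}(t)=\sum_{\substack{\tau\lhd\mu,\ |\tau|\le k_2+k_3\\ \rho\vdash k_2+k_3-|\tau|}}\ \sum_{\substack{\nu\lhd\tau\cup\rho,\ |\nu|\le k_3\\ \xi\vdash k_3-|\nu|}}\frac{(-1)^{l(\xi)+l(\rho)}}{z_\xi(t)\,z_\rho(t)};$$ (4) for all integers $h_1\ge h_2\ge1$ with $h_1+h_2\le n$, $$X^{(h_1,h_2,1^{n-h_1-h_2})}_{\mu}(t)=\sum_{\substack{\tau\lhd\mu,\ |\tau|\le n-h_1\\ \rho\vdash n-h_1-|\tau|}}\ \sum_{\substack{\nu\lhd\tau\cup\rho\\ h_2\le|\nu|\le n-h_1}}\frac{\prod_{i=1}^{n-h_1-h_2}(t^i-1)\ \prod_{l\ge1}(t^{\nu_l}-1)}{z_\rho\ \prod_{j\ge1}(t^{\tau_j}-1)}.$$ -/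

import Mathlib

open scoped Nat

noncomputable section

namespace HallLittlewood

/-- The ground field `F = ℚ(t)`. -/
abbrev F : Type := RatFunc ℚ

/-- The indeterminate `t` of `F`. -/
def t : F := RatFunc.X

/-- The ring of formal power series over `ℚ(t)` in the variables `x₀, x₁, x₂, …`, which contains the
ring `Λ_F` of symmetric functions. All power sums and Hall-Littlewood functions below are elements
of `Λ_F`. -/
abbrev Ser : Type := MvPowerSeries ℕ F

/-! ### Partitions

A partition is given by the multiset of its (nonzero) parts. -/

/-- `z_ρ = ∏_{i ≥ 1} i ^ {m_i} m_i!`, where `m_i` is the multiplicity of `i` in `ρ`. -/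
def z (ρ : Multiset ℕ) : ℕ :=
  ∏ i ∈ ρ.toFinset, i ^ (ρ.count i) * (ρ.count i)!

/-- `z_ρ(t) = z_ρ / ∏_i (1 - t ^ {ρ_i})`. -/
def zt (ρ : Multiset ℕ) : F :=
  (z ρ : F) / (ρ.map fun i => 1 - t ^ i).prod

/-- `[ρ] = ∏_j (t ^ {ρ_j} - 1)`. -/
def bracket (ρ : Multiset ℕ) : F :=
  (ρ.map fun i => t ^ i - 1).prod

/-- `[n]! = ∏_{i = 1}^n (t ^ i - 1)`. -/
def tfact (n : ℕ) : F :=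
  ∏ i ∈ Finset.Icc 1 n, (t ^ i - 1)

/-- `∑ f τ` over all subpartitions `τ ◁ μ` with the property `P`. A subpartition of
`μ = (μ_1, …, μ_l)` is a choice of indices `i_1 < … < i_s`, so that the multiset `τ` of the chosen
parts is counted once for each index set giving it; `Multiset.powerset` has these multiplicities. -/
def subSum (μ : Multiset ℕ) (P : Multiset ℕ → Prop) [DecidablePred P] (f : Multiset ℕ → F) : F :=
  ((μ.powerset.filter P).map f).sum

/-! ### Symmetric functions -/

open Classical in
/-- The power sum `p_n = ∑_i x_i ^ n`, for `n ≥ 1`. -/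
def psum (n : ℕ) : Ser := fun m => if ∃ i, m = Finsupp.single i n then 1 else 0

/-- `p_ρ = ∏_i p_{ρ_i}`. -/
def psumPart (ρ : Multiset ℕ) : Ser := (ρ.map psum).prod

/-- `q_a = ∑_{ρ ⊢ a} z_ρ(t)⁻¹ p_ρ` for an integer `a ≥ 0`, and `q_a = 0` for `a < 0`. -/
def q (a : ℤ) : Ser :=
  if 0 ≤ a then ∑ ρ : a.toNat.Partition, (zt ρ.parts)⁻¹ • psumPart ρ.parts else 0

/-- The coefficient of `R ^ m` in `(1 - R) / (1 - t R) = 1 + ∑_{m ≥ 1} (t ^ m - t ^ (m - 1)) R ^ m`. -/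
def raisingCoeff (m : ℕ) : F := if m = 0 then 1 else t ^ m - t ^ (m - 1)

/-- The pairs `i < j` of positions in a sequence of length `l`. -/
abbrev Pairs (l : ℕ) : Type := {p : Fin l × Fin l // p.1 < p.2}

/-- The sequence `∏_{i < j} R_{ij} ^ {m_{ij}} L`, where `R_{ij}` adds `1` to the `i`-th entry and
subtracts `1` from the `j`-th entry. -/
def raise (L : List ℕ) (m : Pairs L.length → ℕ) (a : Fin L.length) : ℤ :=
  (L.get a : ℤ) + ∑ p : Pairs L.length,
    ((if p.1.1 = a then (m p : ℤ) else 0) - (if p.1.2 = a then (m p : ℤ) else 0))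

/-- The term of index `m` in the expansion of
`∏_{i < j} (1 - R_{ij}) / (1 - t R_{ij}) q_{L_1} ⋯ q_{L_l}`. -/
def raisingTerm (L : List ℕ) (m : Pairs L.length → ℕ) : Ser :=
  (∏ p, raisingCoeff (m p)) • ∏ a, q (raise L m a)

/-- The Hall-Littlewood function
`Q_L(t) = ∏_{i < j} (1 - R_{ij}) / (1 - t R_{ij}) q_{L_1} ⋯ q_{L_l}`. The sum is over all
exponents `m` and has finitely many nonzero terms, see `finite_support_raisingTerm`. -/
def hallQ (L : List ℕ) : Ser := ∑ᶠ m : Pairs L.length → ℕ, raisingTerm L m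

/-- `b_λ(t) = ∏_{i ≥ 1} ∏_{j = 1}^{m_i} (1 - t ^ j)`, which is `(1 - t) ^ {l(λ)} ∏_i [m_i]!` with
`[m]! = ∏_{j = 1}^m (1 - t ^ j) / (1 - t)`. -/
def b (lam : Multiset ℕ) : F :=
  ∏ i ∈ lam.toFinset, ∏ j ∈ Finset.Icc 1 (lam.count i), (1 - t ^ j)

/-- The Hall-Littlewood function `P_λ(t) = b_λ(t)⁻¹ Q_λ(t)` of the partition with the given parts
(taken in decreasing order). -/
def hallP (lam : Multiset ℕ) : Ser :=
  (b lam)⁻¹ • hallQ (lam.sort (· ≥ ·))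

/-- `X λ μ` are the coefficients `X^λ_μ(t)` of the power sum functions in terms of the
Hall-Littlewood functions: `p_μ = ∑_λ X^λ_μ(t) P_λ(t)` for all `μ ⊢ n`. -/
def IsGreen (n : ℕ) (X : n.Partition → n.Partition → F) : Prop :=
  ∀ mu : n.Partition, psumPart mu.parts = ∑ lam : n.Partition, X lam mu • hallP lam.parts

theorem raise_nonneg_of_ne_zero (L : List ℕ) (m : Pairs L.length → ℕ)
    (h : raisingTerm L m ≠ 0) (a : Fin L.length) : 0 ≤ raise L m a := by
  by_contra hneg
  apply h
  unfold raisingTerm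
  rw [Finset.prod_eq_zero (Finset.mem_univ a) (by simp [q, hneg]), smul_zero]

theorem finite_support_raisingTerm (L : List ℕ) : (Function.support (raisingTerm L)).Finite := by
  classical
  apply Set.Finite.subset (Set.finite_Iic (fun _ : Pairs L.length => ∑ a, L.get a))
  intro m hm p
  have hnn := raise_nonneg_of_ne_zero L m hm
  have h1 : 0 ≤ ∑ a, if p.1.2 ≤ a then raise L m a else 0 :=
    Finset.sum_nonneg fun a _ => by split_ifs <;> simp [hnn]
  have h2 : (∑ a, if p.1.2 ≤ a then raise L m a else 0) =
      (∑ a, if p.1.2 ≤ a then (L.get a : ℤ) else 0) +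
      ∑ r : Pairs L.length, ((if p.1.2 ≤ r.1.1 then (m r : ℤ) else 0) -
        (if p.1.2 ≤ r.1.2 then (m r : ℤ) else 0)) := by
    have : ∀ a, (if p.1.2 ≤ a then raise L m a else 0) =
        (if p.1.2 ≤ a then (L.get a : ℤ) else 0) + ∑ r : Pairs L.length,
        ((if r.1.1 = a then (if p.1.2 ≤ a then (m r : ℤ) else 0) else 0) -
          (if r.1.2 = a then (if p.1.2 ≤ a then (m r : ℤ) else 0) else 0)) := by
      intro a
      split_ifs <;> simp [raise]
    simp_rw [this]
    rw [Finset.sum_add_distrib, Finset.sum_comm]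
    congr 1
    apply Finset.sum_congr rfl
    intro r _
    rw [Finset.sum_sub_distrib, Finset.sum_ite_eq, Finset.sum_ite_eq]
    simp
  have h3 : (∑ r : Pairs L.length, ((if p.1.2 ≤ r.1.1 then (m r : ℤ) else 0) -
        (if p.1.2 ≤ r.1.2 then (m r : ℤ) else 0))) ≤
      ∑ r : Pairs L.length, (if r = p then -(m p : ℤ) else 0) := by
    apply Finset.sum_le_sum
    intro r _
    have hr := r.2
    by_cases hrp : r = p
    · subst hrp
      simp [not_le.mpr hr]
    · simp only [hrp, if_false]
      split_ifs with h4 h5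
      · simp
      · exact absurd (h4.trans hr.le) h5
      · simp
      · simp
  have h4 : (∑ a, if p.1.2 ≤ a then (L.get a : ℤ) else 0) ≤ ∑ a, (L.get a : ℤ) :=
    Finset.sum_le_sum fun a _ => by split_ifs <;> simp
  have h5 : (∑ r : Pairs L.length, (if r = p then -(m p : ℤ) else 0)) = -(m p : ℤ) := by
    simp
  have : (m p : ℤ) ≤ ((∑ a, L.get a : ℕ) : ℤ) := by
    push_cast
    linarith
  exact_mod_cast this

end HallLittlewood

end

open HallLittlewood

noncomputable section

namespace HallLittlewood

/-! The proof uses vertex operators on the polynomial ring `Lam` in abstract power sums. Put Q(y) =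
Σ q_a y^a = exp Σ (1 - t^n) p_n y^n / n and E(y) = 1 / Q(y). `addRow m` takes f to the coefficient
of y^m in Q(y) f(p_n - y^{-n}), and `delRow n` takes f to the coefficient of y^{-n} in E(y) f(p_n +
y^{-n}).

The substitution p_n ↦ p_n - y^{-n} multiplies Q(u) by (1 - u/y) / (1 - t u/y), so adding the rows
of λ to 1 one by one reproduces the raising operator formula for Q_λ (`qHat_eq_sum_box`,
`evalPsum_qHat`).

The two families satisfy a quadratic relation (`exists_delRow_addRow`), which shows that removing
the rows of κ and then taking the constant term is a functional dual to the Q_λ: it takes Q_λ to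
δ_{κλ} b_λ(t) (`green_qHat`). As the p_μ are linearly independent, this gives existence and
uniqueness of the X^λ_μ and identifies X^λ_μ with the functional of λ applied to p_μ
(`isGreen_green_and_unique`).

Since `delRow` is explicit on p_μ, removing the first row gives a recursion (`green_cons_pMon`).
Starting from the value 1 on one row, it yields two and three rows. For columns and hooks the sums
collapse by Σ_{ρ ⊢ a} 1/z_ρ = 1 and Σ_{τ ◁ μ} [τ] = t^{|μ|}. -/

/-! ### Partitions as multisets and the numbers z_ρ. -/

/-- The multisets of positive integers with sum `a`. -/
def partsOf (a : ℕ) : Finset (Multiset ℕ) :=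
  Finset.univ.image fun ρ : a.Partition => ρ.parts

theorem mem_partsOf {a : ℕ} {ρ : Multiset ℕ} :
    ρ ∈ partsOf a ↔ (∀ i ∈ ρ, 0 < i) ∧ ρ.sum = a := by
  simp only [partsOf, Finset.mem_image, Finset.mem_univ, true_and]
  constructor
  · rintro ⟨p, rfl⟩
    exact ⟨fun i hi => p.parts_pos hi, p.parts_sum⟩
  · rintro ⟨h1, h2⟩
    exact ⟨⟨ρ, fun hi => h1 _ hi, h2⟩, rfl⟩

theorem sum_partsOf {M : Type*} [AddCommMonoid M] (a : ℕ) (f : Multiset ℕ → M) :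
    ∑ ρ ∈ partsOf a, f ρ = ∑ ρ : a.Partition, f ρ.parts := by
  classical
  rw [partsOf, Finset.sum_image]
  intro p _ q _ h
  exact Nat.Partition.ext h

theorem z_eq_prod (ρ : Multiset ℕ) {s : Finset ℕ} (hs : ρ.toFinset ⊆ s) :
    z ρ = ∏ i ∈ s, i ^ (ρ.count i) * (ρ.count i)! := by
  refine Finset.prod_subset hs fun i _ hi => ?_
  rw [Multiset.mem_toFinset] at hi
  simp [Multiset.count_eq_zero_of_notMem hi]

theorem z_cons (k : ℕ) (ρ : Multiset ℕ) : z (k ::ₘ ρ) = k * (ρ.count k + 1) * z ρ := by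
  have hk : k ∈ insert k ρ.toFinset := Finset.mem_insert_self _ _
  rw [z_eq_prod (k ::ₘ ρ) (s := insert k ρ.toFinset) (by simp),
    z_eq_prod ρ (s := insert k ρ.toFinset) (by simp), ← Finset.mul_prod_erase _ _ hk,
    ← Finset.mul_prod_erase _ _ hk, Multiset.count_cons_self, pow_succ, Nat.factorial_succ]
  rw [Finset.prod_congr rfl (g := fun i => i ^ (ρ.count i) * (ρ.count i)!)]
  · ring
  · intro i hi
    rw [Multiset.count_cons_of_ne (Finset.ne_of_mem_erase hi)]

theorem sum_eq_sum_count (ρ : Multiset ℕ) : ρ.sum = ∑ k ∈ ρ.toFinset, k * ρ.count k := by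
  rw [Finset.sum_multiset_count]
  simp [mul_comm]

/-! ### Series of the form exp Σ x_n y^n / n, handled through their differential equation. -/

section hsum

variable {R S : Type*} [CommRing R] [Algebra F R] [CommRing S] [Algebra F S]

/-- `∑_{ρ ⊢ a} z_ρ⁻¹ x_ρ`, the complete symmetric function of degree `a` with power sums `x`. -/
def hsum (x : ℕ → R) (a : ℕ) : R :=
  ∑ ρ ∈ partsOf a, (z ρ : F)⁻¹ • (ρ.map x).prod

theorem hsum_zero (x : ℕ → R) : hsum x 0 = 1 := by
  have : partsOf 0 = {0} := by
    ext ρ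
    rw [mem_partsOf, Finset.mem_singleton]
    constructor
    · rintro ⟨h1, h2⟩
      refine Multiset.eq_zero_of_forall_notMem fun i hi => ?_
      have := Multiset.le_sum_of_mem hi
      have := h1 i hi
      omega
    · rintro rfl
      simp
  simp [hsum, this, z]

theorem map_hsum (f : R →ₐ[F] S) (x : ℕ → R) (a : ℕ) :
    f (hsum x a) = hsum (fun n => f (x n)) a := by
  simp [hsum, map_sum, map_multiset_prod, Multiset.map_map]

theorem hsum_pow_mul (c : R) (x : ℕ → R) (a : ℕ) :
    hsum (fun n => c ^ n * x n) a = c ^ a * hsum x a := by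
  rw [hsum, hsum, Finset.mul_sum]
  refine Finset.sum_congr rfl fun ρ hρ => ?_
  rw [Multiset.prod_map_mul, mul_smul_comm]
  congr 2
  rw [← (mem_partsOf.1 hρ).2]
  induction ρ using Multiset.induction_on generalizing a with
  | empty => simp
  | cons k σ ih =>
    rw [Multiset.map_cons, Multiset.prod_cons, Multiset.sum_cons, pow_add,
      ih σ.sum (mem_partsOf.2
        ⟨fun i hi => (mem_partsOf.1 hρ).1 i (Multiset.mem_cons_of_mem hi), rfl⟩)]

/-- Write a = Σ k m_k(ρ) over the distinct parts k of ρ and remove one part k, leaving σ: since z_ρ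
= k m_k(ρ) z_σ, the weights match. The index 0 of the antidiagonal has to be discarded because parts
are positive. -/
theorem hsum_newton (x : ℕ → R) (a : ℕ) :
    (a : F) • hsum x a =
      ∑ p ∈ Finset.HasAntidiagonal.antidiagonal a, (if p.1 = 0 then 0 else x p.1) * hsum x p.2 := by
  have h1 : (a : F) • hsum x a = ∑ ρ ∈ partsOf a, ∑ k ∈ ρ.toFinset,
      ((k * ρ.count k : ℕ) : F) • (z ρ : F)⁻¹ • (ρ.map x).prod := by
    rw [hsum, Finset.smul_sum]
    refine Finset.sum_congr rfl fun ρ hρ => ?_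
    rw [← Finset.sum_smul, ← Nat.cast_sum, ← sum_eq_sum_count, (mem_partsOf.1 hρ).2]
  have h2 : ∑ p ∈ Finset.HasAntidiagonal.antidiagonal a,
      (if p.1 = 0 then 0 else x p.1) * hsum x p.2 =
      ∑ p ∈ (Finset.HasAntidiagonal.antidiagonal a).filter (fun p => p.1 ≠ 0), ∑ ρ ∈ partsOf p.2,
        x p.1 * ((z ρ : F)⁻¹ • (ρ.map x).prod) := by
    rw [Finset.sum_filter]
    refine Finset.sum_congr rfl fun p _ => ?_
    by_cases h : p.1 = 0 <;> simp [h, hsum, Finset.mul_sum]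
  rw [h1, h2, Finset.sum_sigma', Finset.sum_sigma']
  refine Finset.sum_bij' (fun q _ => ⟨(q.2, a - q.2), q.1.erase q.2⟩)
    (fun q _ => ⟨q.1.1 ::ₘ q.2, q.1.1⟩) ?_ ?_ ?_ ?_ ?_
  · rintro ⟨ρ, k⟩ h
    simp only [Finset.mem_sigma, mem_partsOf, Multiset.mem_toFinset] at h
    obtain ⟨⟨h1, h2⟩, h3⟩ := h
    have h4 := Multiset.sum_erase h3
    have h5 := h1 k h3
    simp only [Finset.mem_sigma, mem_partsOf, Finset.mem_filter,
      Finset.HasAntidiagonal.mem_antidiagonal]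
    exact ⟨⟨by omega, by omega⟩, fun i hi => h1 i (Multiset.mem_of_mem_erase hi), by omega⟩
  · rintro ⟨⟨k, j⟩, ρ⟩ h
    simp only [Finset.mem_sigma, mem_partsOf, Finset.mem_filter,
      Finset.HasAntidiagonal.mem_antidiagonal] at h
    obtain ⟨⟨h1, h2⟩, h3, h4⟩ := h
    simp only [Finset.mem_sigma, mem_partsOf, Multiset.mem_toFinset, Multiset.mem_cons,
      Multiset.sum_cons, true_or, and_true]
    refine ⟨?_, by omega⟩
    rintro i (rfl | hi)
    · omega
    · exact h3 i hi
  · rintro ⟨ρ, k⟩ h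
    simp only [Finset.mem_sigma, Multiset.mem_toFinset] at h
    simp [Multiset.cons_erase h.2]
  · rintro ⟨⟨k, j⟩, ρ⟩ h
    simp only [Finset.mem_sigma, mem_partsOf, Finset.mem_filter,
      Finset.HasAntidiagonal.mem_antidiagonal] at h
    have : a - k = j := by omega
    simp [this]
  · rintro ⟨ρ, k⟩ h
    simp only [Finset.mem_sigma, mem_partsOf, Multiset.mem_toFinset] at h
    obtain ⟨⟨h1, h2⟩, h3⟩ := h
    obtain ⟨σ, rfl⟩ := Multiset.exists_cons_of_mem h3
    have hk : (k : F) ≠ 0 := Nat.cast_ne_zero.2 (h1 k h3).ne'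
    have hc : ((σ.count k : F) + 1) ≠ 0 := by
      exact_mod_cast Nat.succ_ne_zero (σ.count k)
    simp only [Multiset.erase_cons_head, z_cons, Multiset.map_cons, Multiset.prod_cons,
      Multiset.count_cons_self, smul_smul, mul_smul_comm]
    congr 1
    push_cast
    field_simp

open PowerSeries in
theorem derivative_mk_hsum (x : ℕ → R) :
    X * d⁄dX R (mk (hsum x)) = mk (fun k => if k = 0 then 0 else x k) * mk (hsum x) := by
  ext a
  conv_rhs => rw [coeff_mul]
  simp only [coeff_mk]
  refine Eq.trans ?_ (hsum_newton x a)
  cases a with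
  | zero => simp
  | succ a =>
    rw [coeff_succ_X_mul, coeff_derivative, coeff_mk, Algebra.smul_def]
    push_cast
    simp [mul_comm]

open PowerSeries in
-- In characteristic 0 the equation y G' = (Σ x_k y^k) G and G(0) = 1 determine the coefficients
-- recursively. This replaces the exponential in all later identities of series.
theorem eq_mk_hsum (x : ℕ → R) (G : PowerSeries R) (h0 : coeff 0 G = 1)
    (hG : X * d⁄dX R G = mk (fun k => if k = 0 then 0 else x k) * G) :
    G = mk (hsum x) := by
  ext a
  rw [coeff_mk]
  induction a using Nat.strong_induction_on with
  | _ a ih =>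
    cases a with
    | zero => rw [h0, hsum_zero]
    | succ a =>
      have h1 := congrArg (coeff (a + 1)) hG
      have h2 := hsum_newton x (a + 1)
      rw [coeff_succ_X_mul, coeff_derivative, coeff_mul] at h1
      simp only [coeff_mk] at h1
      have h3 : ((a + 1 : ℕ) : F) • coeff (a + 1) G = ((a + 1 : ℕ) : F) • hsum x (a + 1) := by
        rw [h2, Algebra.smul_def]
        push_cast
        rw [mul_comm, h1]
        refine Finset.sum_congr rfl fun p hp => ?_
        by_cases hp0 : p.1 = 0
        · simp [hp0]
        · rw [ih]
          have := Finset.HasAntidiagonal.mem_antidiagonal.1 hp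
          omega
      have h4 : ((a + 1 : ℕ) : F) ≠ 0 := Nat.cast_ne_zero.2 (Nat.succ_ne_zero a)
      have h5 := congrArg (fun r => ((a + 1 : ℕ) : F)⁻¹ • r) h3
      simpa only [smul_smul, inv_mul_cancel₀ h4, one_smul] using h5

open PowerSeries in
theorem mk_hsum_add (x y : ℕ → R) :
    mk (hsum fun n => x n + y n) = mk (hsum x) * mk (hsum y) := by
  symm
  apply eq_mk_hsum
  · rw [coeff_zero_eq_constantCoeff_apply, map_mul]
    simp [hsum_zero]
  · rw [Derivation.leibniz, smul_eq_mul, smul_eq_mul]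
    have h : mk (fun k => if k = 0 then 0 else x k + y k) =
        mk (fun k => if k = 0 then 0 else x k) + mk (fun k => if k = 0 then 0 else y k) := by
      ext k
      by_cases hk : k = 0 <;> simp [hk]
    rw [h]
    linear_combination (mk (hsum x)) * derivative_mk_hsum y + (mk (hsum y)) * derivative_mk_hsum x

theorem hsum_add (x y : ℕ → R) (a : ℕ) :
    hsum (fun n => x n + y n) a =
      ∑ p ∈ Finset.HasAntidiagonal.antidiagonal a, hsum x p.1 * hsum y p.2 := by
  have := congrArg (PowerSeries.coeff a) (mk_hsum_add x y)
  simpa [PowerSeries.coeff_mul] using this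

open PowerSeries in
theorem mk_hsum_one : mk (hsum (1 : ℕ → R)) * (1 - X) = 1 := by
  have h : mk (hsum (1 : ℕ → R)) = mk 1 := by
    symm
    apply eq_mk_hsum
    · simp
    · have h1 := PowerSeries.mk_one_mul_one_sub_eq_one R
      have h2 := congrArg (d⁄dX R) h1
      simp only [Derivation.leibniz, map_sub, derivative_X, smul_eq_mul,
        Derivation.map_one_eq_zero] at h2
      have h3 : mk (fun k => if k = 0 then (0 : R) else (1 : ℕ → R) k) = mk 1 - 1 := by
        ext k
        by_cases hk : k = 0 <;> simp [hk, coeff_one]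
      rw [h3]
      linear_combination (X * mk 1) * h2 - (X * d⁄dX R (mk 1) + mk 1) * h1
  rw [h, PowerSeries.mk_one_mul_one_sub_eq_one]

theorem hsum_one (a : ℕ) : hsum (1 : ℕ → R) a = 1 := by
  have h1 : PowerSeries.mk (hsum (1 : ℕ → R)) = PowerSeries.mk 1 :=
    calc _ = PowerSeries.mk (hsum (1 : ℕ → R)) *
          (PowerSeries.mk 1 * (1 - PowerSeries.X)) := by
            rw [PowerSeries.mk_one_mul_one_sub_eq_one, mul_one]
      _ = _ := by linear_combination (PowerSeries.mk 1) * mk_hsum_one (R := R)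
  simpa using congrArg (PowerSeries.coeff a) h1

theorem hsum_pow (c : R) (a : ℕ) : hsum (fun n => c ^ n) a = c ^ a := by
  have := hsum_pow_mul c (1 : ℕ → R) a
  simpa [hsum_one] using this

open PowerSeries in
theorem mk_hsum_zero : mk (hsum (0 : ℕ → R)) = 1 := by
  symm
  apply eq_mk_hsum
  · simp
  · rw [Derivation.map_one_eq_zero, mul_zero, mul_one]
    ext k
    simp

open PowerSeries in
theorem mk_hsum_mul_neg (x : ℕ → R) :
    mk (hsum x) * mk (hsum fun n => -x n) = 1 := by
  rw [← mk_hsum_add, ← mk_hsum_zero]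
  simp [Pi.zero_def]

open PowerSeries in
theorem mk_hsum_neg_pow (c : R) : mk (hsum fun n => -c ^ n) = 1 - C c * X := by
  have h1 : mk (hsum fun n => c ^ n) * (1 - C c * X) = 1 := by
    ext a
    cases a with
    | zero => simp [hsum_zero, mul_sub]
    | succ a =>
      rw [mul_sub, mul_one, map_sub, coeff_mk, mul_left_comm, coeff_C_mul, coeff_succ_mul_X,
        coeff_mk, hsum_pow, hsum_pow, coeff_one]
      simp [pow_succ']
  have h2 := mk_hsum_mul_neg fun n => c ^ n
  linear_combination (1 - C c * X) * h2 - mk (hsum fun n => -c ^ n) * h1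

theorem sum_hsum_mul_hsum_neg (x : ℕ → R) (a : ℕ) :
    ∑ p ∈ Finset.HasAntidiagonal.antidiagonal a, hsum x p.1 * hsum (fun n => -x n) p.2 =
      if a = 0 then 1 else 0 := by
  have := congrArg (PowerSeries.coeff a) (mk_hsum_mul_neg x)
  simpa [PowerSeries.coeff_mul, PowerSeries.coeff_one] using this

end hsum

/-- The coefficients of `(1 - t y) / (1 - y)`. -/
def loweringCoeff (m : ℕ) : F := if m = 0 then 1 else 1 - t

/-- The series of 1 is 1 / (1 - y) and that of -t^n is 1 - t y; the product is (1 - t y) / (1 - y).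
-/
theorem hsum_one_sub_t_pow (a : ℕ) : hsum (fun n => 1 - t ^ n) a = loweringCoeff a := by
  have h1 := mk_hsum_add (1 : ℕ → F) (fun n => -t ^ n)
  rw [mk_hsum_neg_pow] at h1
  have h2 := congrArg (PowerSeries.coeff a) h1
  simp only [Pi.one_apply, ← sub_eq_add_neg, PowerSeries.coeff_mk] at h2
  rw [h2]
  cases a with
  | zero => simp [hsum_one, loweringCoeff, mul_sub]
  | succ a =>
    rw [mul_sub, mul_one, map_sub, PowerSeries.coeff_mk, mul_left_comm, PowerSeries.coeff_C_mul,
      PowerSeries.coeff_succ_mul_X, PowerSeries.coeff_mk, hsum_one, hsum_one]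
    simp [loweringCoeff]

/-- This is the source of the raising operators: the exponential series with power sums -(1 - t^n)
is (1 - y) / (1 - t y). -/
theorem hsum_neg_one_sub_t_pow (a : ℕ) : hsum (fun n => -(1 - t ^ n)) a = raisingCoeff a := by
  have h1 := mk_hsum_add (fun n => -(1 : F) ^ n) (fun n => t ^ n)
  rw [mk_hsum_neg_pow] at h1
  have h2 := congrArg (PowerSeries.coeff a) h1
  simp only [one_pow, PowerSeries.coeff_mk, map_one, one_mul] at h2
  have h3 : (fun n : ℕ => -(1 - t ^ n)) = fun n => -1 + t ^ n := by
    ext n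
    ring
  rw [h3, h2]
  cases a with
  | zero => simp [hsum_pow, raisingCoeff, sub_mul]
  | succ a =>
    rw [sub_mul, one_mul, map_sub, PowerSeries.coeff_mk, PowerSeries.coeff_succ_X_mul,
      PowerSeries.coeff_mk, hsum_pow, hsum_pow]
    simp [raisingCoeff]

/-! ### Vertex operators on abstract power sums. -/

/-- The polynomial ring in abstract power sums: the variable `n` stands for `p_n`. -/
abbrev Lam : Type := MvPolynomial ℕ F

/-- The monomial `p_ρ`. -/
def pMon (ρ : Multiset ℕ) : Lam := (ρ.map MvPolynomial.X).prod

/-- `∑_{ρ ⊢ a} z_ρ⁻¹ w_ρ p_ρ`, and `0` for `a < 0`. -/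
def hz (w : ℕ → F) (a : ℤ) : Lam :=
  if 0 ≤ a then hsum (fun n => w n • (MvPolynomial.X n : Lam)) a.toNat else 0

theorem hz_of_neg (w : ℕ → F) {a : ℤ} (ha : a < 0) : hz w a = 0 := if_neg (not_le.2 ha)

theorem hz_natCast (w : ℕ → F) (a : ℕ) :
    hz w a = hsum (fun n => w n • (MvPolynomial.X n : Lam)) a := by
  simp [hz]

/-- The weights of `q_a`. -/
def qWeight (n : ℕ) : F := 1 - t ^ n

/-- The weights of the inverse of `∑ q_a y ^ a`. -/
def eWeight (n : ℕ) : F := -(1 - t ^ n)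

theorem sum_hz_mul_hz (s : ℕ) :
    ∑ p ∈ Finset.HasAntidiagonal.antidiagonal s, hz eWeight p.1 * hz qWeight p.2 =
      if s = 0 then 1 else 0 := by
  have h := sum_hsum_mul_hsum_neg (fun n => eWeight n • (MvPolynomial.X n : Lam)) s
  rw [← h]
  refine Finset.sum_congr rfl fun p _ => ?_
  rw [hz_natCast, hz_natCast]
  congr 2
  ext1 n
  rw [← neg_smul, eWeight, neg_neg, qWeight]

/-- The substitution `p_n ↦ p_n + ε y ^ n`. -/
def shift (ε : F) : Lam →ₐ[F] Polynomial Lam :=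
  MvPolynomial.aeval fun n => Polynomial.C (MvPolynomial.X n) + ε • Polynomial.X ^ n

/-- The linear map sending `y ^ j` to `h (m + j)`. -/
def readOff (h : ℤ → Lam) (m : ℤ) : Polynomial Lam →ₗ[Lam] Lam :=
  Polynomial.lsum fun j => LinearMap.mulRight Lam (h (m + j))

theorem readOff_monomial (h : ℤ → Lam) (m : ℤ) (j : ℕ) (p : Lam) :
    readOff h m (Polynomial.monomial j p) = p * h (m + j) := by
  simp [readOff, Polynomial.lsum_apply, Polynomial.sum_monomial_index]

theorem readOff_C_mul (h : ℤ → Lam) (m : ℤ) (p : Lam) (g : Polynomial Lam) :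
    readOff h m (Polynomial.C p * g) = p * readOff h m g := by
  rw [← Polynomial.smul_eq_C_mul, map_smul, smul_eq_mul]

theorem readOff_X_pow_mul (h : ℤ → Lam) (m : ℤ) (k : ℕ) (g : Polynomial Lam) :
    readOff h m (Polynomial.X ^ k * g) = readOff h (m + k) g := by
  induction g using Polynomial.induction_on' with
  | add p q hp hq => rw [mul_add, map_add, hp, hq, map_add]
  | monomial j p =>
    rw [Polynomial.X_pow_mul_monomial, readOff_monomial, readOff_monomial]
    congr 2
    push_cast
    ring

/-- The component of degree `m` of the vertex operator `∑ h_j y ^ j · (p_n ↦ p_n + ε y ^ {-n})`. -/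
def vertex (ε : F) (h : ℤ → Lam) (m : ℤ) : Lam →ₗ[F] Lam :=
  (readOff h m).restrictScalars F ∘ₗ (shift ε).toLinearMap

theorem vertex_apply (ε : F) (h : ℤ → Lam) (m : ℤ) (f : Lam) :
    vertex ε h m f = readOff h m (shift ε f) := rfl

theorem vertex_one (ε : F) (h : ℤ → Lam) (m : ℤ) : vertex ε h m 1 = h m := by
  rw [vertex_apply, map_one, ← Polynomial.monomial_zero_one, readOff_monomial]
  simp

/-- The substitution turns the factor p_k into p_k + ε y^{-k}, and y^{-k} moves the index by k. This
commutator with p_k drives the induction on polynomials below. -/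
theorem vertex_mul_X (ε : F) (h : ℤ → Lam) (m : ℤ) (f : Lam) (k : ℕ) :
    vertex ε h m (f * MvPolynomial.X k) =
      vertex ε h m f * MvPolynomial.X k + ε • vertex ε h (m + k) f := by
  have hs : shift ε (f * MvPolynomial.X k) =
      Polynomial.C (MvPolynomial.X k) * shift ε f + ε • (Polynomial.X ^ k * shift ε f) := by
    rw [map_mul]
    conv_lhs => enter [2]; rw [shift, MvPolynomial.aeval_X]
    rw [mul_comm, add_mul, smul_mul_assoc]
  rw [vertex_apply, hs, map_add, readOff_C_mul, mul_comm, LinearMap.map_smul_of_tower,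
    readOff_X_pow_mul]
  rfl

/-- A sum of power sums becomes a product of exponential series, one factor depending only on the
shift. Any N > a serves as cutoff, since the terms with i > a vanish; this also covers a < 0. -/
theorem shift_hz (ε : F) (w : ℕ → F) {a : ℤ} {N : ℕ} (haN : a < N) :
    shift ε (hz w a) = ∑ i ∈ Finset.range N,
      hsum (fun n => ε * w n) i • (Polynomial.X ^ i * Polynomial.C (hz w (a - i))) := by
  by_cases ha : a < 0
  · rw [hz_of_neg w ha, map_zero, Finset.sum_eq_zero]
    intro i _
    rw [hz_of_neg w (by omega)]
    simp
  obtain ⟨a, rfl⟩ := Int.eq_ofNat_of_zero_le (not_lt.1 ha)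
  rw [hz_natCast, map_hsum]
  have h1 : (fun n => shift ε (w n • (MvPolynomial.X n : Lam))) = fun n =>
      Polynomial.X ^ n * algebraMap F (Polynomial Lam) (ε * w n) +
        Polynomial.CAlgHom (R := F) (w n • (MvPolynomial.X n : Lam)) := by
    ext1 n
    rw [map_smul, shift, MvPolynomial.aeval_X, Polynomial.CAlgHom_apply, smul_add, smul_smul,
      ← Polynomial.smul_C, add_comm, mul_comm _ (algebraMap _ _ _), ← Algebra.smul_def,
      mul_comm (w n)]
  rw [h1, hsum_add, Finset.Nat.sum_antidiagonal_eq_sum_range_succ_mk]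
  have h2 : Finset.range (a + 1) ⊆ Finset.range N := Finset.range_mono (by omega)
  rw [← Finset.sum_subset h2]
  · refine Finset.sum_congr rfl fun i hi => ?_
    have hi' : i ≤ a := by
      rw [Finset.mem_range] at hi
      omega
    have h3 : ((a : ℕ) : ℤ) - i = ((a - i : ℕ) : ℤ) := by omega
    rw [h3, hz_natCast, hsum_pow_mul, ← map_hsum, Polynomial.CAlgHom_apply]
    have h4 := map_hsum (Algebra.ofId F (Polynomial Lam)) (fun n => ε * w n) i
    simp only [Algebra.ofId_apply] at h4
    rw [← h4, mul_assoc, Algebra.smul_def]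
    ring
  · intro i _ hi
    rw [hz_of_neg w (by rw [Finset.mem_range] at hi; omega)]
    simp

theorem vertex_hz (ε : F) (h : ℤ → Lam) (w : ℕ → F) (m : ℤ) {a : ℤ} {N : ℕ} (haN : a < N) :
    vertex ε h m (hz w a) = ∑ i ∈ Finset.range N,
      hsum (fun n => ε * w n) i • (h (m + i) * hz w (a - i)) := by
  rw [vertex_apply, shift_hz ε w haN, map_sum]
  refine Finset.sum_congr rfl fun i _ => ?_
  rw [LinearMap.map_smul_of_tower, readOff_X_pow_mul, ← mul_one (Polynomial.C _), readOff_C_mul,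
    ← Polynomial.monomial_zero_one, readOff_monomial]
  simp [mul_comm]

/-- The operator adding a row of length `m`. -/
def addRow (m : ℤ) : Lam →ₗ[F] Lam := vertex (-1) (hz qWeight) m

/-- The operator removing a row of length `n`. -/
def delRow (n : ℤ) : Lam →ₗ[F] Lam := vertex 1 (hz eWeight) (-n)

theorem addRow_one (m : ℤ) : addRow m 1 = hz qWeight m := vertex_one _ _ _

theorem delRow_one (n : ℤ) : delRow n 1 = hz eWeight (-n) := vertex_one _ _ _

theorem addRow_mul_X (m : ℤ) (f : Lam) (k : ℕ) :
    addRow m (f * MvPolynomial.X k) = addRow m f * MvPolynomial.X k - addRow (m + k) f := by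
  rw [addRow, vertex_mul_X, neg_one_smul, ← sub_eq_add_neg]
  rfl

theorem delRow_mul_X (n : ℤ) (f : Lam) (k : ℕ) :
    delRow n (f * MvPolynomial.X k) = delRow n f * MvPolynomial.X k + delRow (n - k) f := by
  rw [delRow, vertex_mul_X, one_smul, delRow]
  congr 3
  ring

theorem delRow_hz (n : ℤ) {a : ℤ} {N : ℕ} (haN : a < N) :
    delRow n (hz qWeight a) = ∑ i ∈ Finset.range N,
      loweringCoeff i • (hz eWeight (-n + i) * hz qWeight (a - i)) := by
  rw [delRow, vertex_hz _ _ _ _ haN]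
  simp only [one_mul, qWeight, hsum_one_sub_t_pow]

theorem addRow_hz (m : ℤ) {a : ℤ} {N : ℕ} (haN : a < N) :
    addRow m (hz eWeight a) = ∑ i ∈ Finset.range N,
      loweringCoeff i • (hz eWeight (a - i) * hz qWeight (m + i)) := by
  rw [addRow, vertex_hz _ _ _ _ haN]
  simp only [eWeight, neg_mul_neg, one_mul, hsum_one_sub_t_pow, mul_comm]

/-! ### The relation between adding and removing rows. -/

/-- The coefficients of `(t - y) / (1 - t y)`. -/
def swapCoeff (j : ℕ) : F := if j = 0 then t else t ^ (j + 1) - t ^ (j - 1)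

theorem sum_swapCoeff (l : ℕ) :
    ∑ k ∈ Finset.range (l + 1), swapCoeff k = t ^ (l + 1) + t ^ l - 1 := by
  induction l with
  | zero => simp [swapCoeff]
  | succ l ih =>
    rw [Finset.sum_range_succ, ih]
    simp [swapCoeff]
    ring

/-- Coefficientwise form of (t - y)/(1 - t y) · (1 - t y)/(1 - y) = (t - 1)/(1 - y) + 1. -/
theorem sum_swapCoeff_mul_loweringCoeff (l : ℕ) :
    ∑ k ∈ Finset.range (l + 1), swapCoeff k * loweringCoeff (l - k) =
      t - 1 + if l = 0 then 1 else 0 := by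
  cases l with
  | zero => simp [swapCoeff, loweringCoeff]
  | succ l =>
    rw [Finset.sum_range_succ, Finset.sum_congr rfl (g := fun k => swapCoeff k * (1 - t)),
      ← Finset.sum_mul, sum_swapCoeff]
    · simp [swapCoeff, loweringCoeff]
      ring
    · intro k hk
      rw [Finset.mem_range] at hk
      rw [loweringCoeff, if_neg (by omega)]

theorem sum_range_add_int {M : Type*} [AddCommMonoid M] (g : ℤ → M) (n : ℤ) (N : ℕ) :
    ∑ i ∈ Finset.range N, g (n + i) = ∑ l ∈ Finset.Ico n (n + N), g l := by
  refine Finset.sum_bij' (fun i _ => n + i) (fun l _ => (l - n).toNat) ?_ ?_ ?_ ?_ ?_ <;>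
    simp only [Finset.mem_range, Finset.mem_Ico] <;> intros <;> first | omega | trivial

theorem sum_range_sub_int {M : Type*} [AddCommMonoid M] (g : ℤ → M) (n : ℤ) (N : ℕ) :
    ∑ i ∈ Finset.range N, g (n - i) = ∑ l ∈ Finset.Ioc (n - N) n, g l := by
  refine Finset.sum_bij' (fun i _ => n - i) (fun l _ => (n - l).toNat) ?_ ?_ ?_ ?_ ?_ <;>
    simp only [Finset.mem_range, Finset.mem_Ioc] <;> intros <;> first | omega | trivial

theorem sum_hz_mul_hz_window (s : ℤ) {T : Finset ℤ} (hT : Finset.Icc 0 s ⊆ T) :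
    ∑ l ∈ T, hz eWeight l * hz qWeight (s - l) = if s = 0 then 1 else 0 := by
  rw [← Finset.sum_subset hT (f := fun l => hz eWeight l * hz qWeight (s - l))]
  · by_cases hs : s < 0
    · rw [Finset.Icc_eq_empty (by omega), if_neg hs.ne]
      rfl
    · obtain ⟨s, rfl⟩ := Int.eq_ofNat_of_zero_le (not_lt.1 hs)
      have h := sum_hz_mul_hz s
      rw [Finset.Nat.sum_antidiagonal_eq_sum_range_succ_mk] at h
      simp only [Nat.cast_eq_zero, ← h]
      symm
      refine Finset.sum_bij' (fun i _ => (i : ℤ)) (fun l _ => l.toNat) ?_ ?_ ?_ ?_ ?_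
      all_goals simp only [Finset.mem_range, Finset.mem_Icc]
      all_goals intro i hi
      any_goals omega
      rw [Nat.cast_sub (by omega)]
  · intro l _ hl
    rw [Finset.mem_Icc] at hl
    by_cases h0 : l < 0
    · rw [hz_of_neg _ h0, zero_mul]
    · rw [hz_of_neg qWeight (a := s - l) (by omega), mul_zero]

/-- The relation applied to the constant 1. With g(l) = e_l q_{m-n-l}, the left side is (1 - t) Σ_{l
≥ -n} g(l) + t g(-n) and the sum on the right is (t - 1) Σ_{l ≤ -n} g(l) + g(-n). Their difference
is (1 - t) Σ_l g(l), which E Q = 1 evaluates. -/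
theorem delRow_hz_qWeight (n m : ℤ) {J : ℕ} (hJ : -n < J) :
    delRow n (hz qWeight m) = (if n = m then (1 - t) else 0) • (1 : Lam) +
      ∑ j ∈ Finset.range J, swapCoeff j • addRow (m + j) (hz eWeight (-(n + j))) := by
  set g : ℤ → Lam := fun l => hz eWeight l * hz qWeight (m - n - l) with hg
  have hneg : ∀ l < 0, g l = 0 := fun l hl => by simp [hg, hz_of_neg eWeight hl]
  set N : ℕ := m.toNat + 1 with hN
  have h1 : delRow n (hz qWeight m) =
      (1 - t) • ∑ i ∈ Finset.range N, g (-n + i) + t • g (-n) := by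
    rw [delRow_hz n (N := N) (by omega), Finset.sum_range_succ', Finset.sum_range_succ', smul_add,
      Finset.smul_sum]
    have h2 : ∀ i : ℕ, m - i = m - n - (-n + i) := fun i => by ring
    simp only [h2, hg, loweringCoeff, Nat.add_eq_zero_iff, one_ne_zero, and_false, if_false,
      if_true, Nat.cast_zero, add_zero, add_assoc, ← add_smul]
    rw [sub_add_cancel, sub_neg_eq_add, sub_zero, sub_add_cancel, one_smul]
  have h2 : ∑ j ∈ Finset.range J, swapCoeff j • addRow (m + j) (hz eWeight (-(n + j))) =
      (t - 1) • ∑ l ∈ Finset.range J, g (-n - l) + g (-n) := by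
    have h3 : ∀ j ∈ Finset.range J, swapCoeff j • addRow (m + j) (hz eWeight (-(n + j))) =
        ∑ i ∈ Finset.range (J - j), (swapCoeff j * loweringCoeff i) • g (-n - (j + i : ℕ)) := by
      intro j hj
      rw [Finset.mem_range] at hj
      rw [addRow_hz _ (N := J - j) (by omega), Finset.smul_sum]
      refine Finset.sum_congr rfl fun i _ => ?_
      simp only [smul_smul, hg]
      congr 3 <;> push_cast <;> ring
    rw [Finset.sum_congr rfl h3, ← Finset.sum_range_diag_flip J
      (fun j i => (swapCoeff j * loweringCoeff i) • g (-n - (j + i : ℕ)))]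
    have h4 : ∀ l ∈ Finset.range J, ∑ k ∈ Finset.range (l + 1),
        (swapCoeff k * loweringCoeff (l - k)) • g (-n - (k + (l - k) : ℕ)) =
        (t - 1) • g (-n - l) + if l = 0 then g (-n) else 0 := by
      intro l _
      rw [Finset.sum_congr rfl (g := fun k => (swapCoeff k * loweringCoeff (l - k)) • g (-n - l)),
        ← Finset.sum_smul, sum_swapCoeff_mul_loweringCoeff, add_smul]
      · by_cases hl : l = 0 <;> simp [hl]
      · intro k hk
        rw [Finset.mem_range] at hk
        rw [Nat.add_sub_cancel' (by omega)]
    rw [Finset.sum_congr rfl h4, Finset.sum_add_distrib, Finset.smul_sum, Finset.sum_ite_eq']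
    congr 1
    split_ifs with hJ0
    · rfl
    · rw [hneg]
      rw [Finset.mem_range] at hJ0
      omega
  -- The two windows together cover the support of g and overlap at most in l = -n, hence the extra
  -- g(-n). If J = 0 they are disjoint, but then -n < 0 and g(-n) = 0.
  have h5 : ∑ i ∈ Finset.range N, g (-n + i) + ∑ l ∈ Finset.range J, g (-n - l) =
      (if n = m then 1 else 0) + g (-n) := by
    rw [sum_range_add_int, sum_range_sub_int, ← Finset.sum_union_inter]
    congr 1
    · rw [sum_hz_mul_hz_window]
      · simp only [sub_eq_zero, eq_comm]
      · intro l
        simp only [Finset.mem_Icc, Finset.mem_union, Finset.mem_Ico, Finset.mem_Ioc]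
        omega
    · by_cases hn : -n < 0
      · rw [hneg _ hn]
        refine Finset.sum_eq_zero fun l hl => hneg _ ?_
        simp only [Finset.mem_inter, Finset.mem_Ico, Finset.mem_Ioc] at hl
        omega
      · rw [Finset.sum_eq_single (-n)]
        · intro l hl hl'
          simp only [Finset.mem_inter, Finset.mem_Ico, Finset.mem_Ioc] at hl
          omega
        · simp only [Finset.mem_inter, Finset.mem_Ico, Finset.mem_Ioc]
          omega
  rw [h1, h2]
  have h6 : ((if n = m then (1 - t) else 0) • (1 : Lam)) =
      (1 - t) • (if n = m then (1 : Lam) else 0) := by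
    split_ifs <;> simp
  rw [h6, eq_sub_of_add_eq h5]
  simp only [MvPolynomial.smul_eq_C_mul, map_sub, map_one]
  ring

/-- K is a bound from which on `delRow n f` vanishes, so that the infinite sum over j may be cut at
J. The constant case is `delRow_hz_qWeight`; it propagates because multiplication by p_k changes
both sides in the same way. -/
theorem exists_delRow_addRow (f : Lam) : ∃ K : ℕ, (∀ n : ℤ, K ≤ n → delRow n f = 0) ∧
    ∀ (n m : ℤ) (J : ℕ), K - n ≤ J → delRow n (addRow m f) =
      (if n = m then (1 - t) else 0) • f +
        ∑ j ∈ Finset.range J, swapCoeff j • addRow (m + j) (delRow (n + j) f) := by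
  induction f using MvPolynomial.induction_on with
  | C a =>
    have ha : (MvPolynomial.C a : Lam) = a • 1 := by rw [MvPolynomial.smul_eq_C_mul, mul_one]
    rw [ha]
    refine ⟨1, fun n hn => ?_, fun n m J hJ => ?_⟩
    · rw [map_smul, delRow_one, hz_of_neg _ (by omega), smul_zero]
    · simp only [map_smul, addRow_one, delRow_one]
      rw [delRow_hz_qWeight n m (J := J) (by omega), smul_add, Finset.smul_sum]
      simp only [smul_comm a]
  | add f g hf hg =>
    obtain ⟨K, hK1, hK2⟩ := hf
    obtain ⟨M, hM1, hM2⟩ := hg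
    refine ⟨max K M, fun n hn => ?_, fun n m J hJ => ?_⟩
    · rw [map_add, hK1 n (by omega), hM1 n (by omega), add_zero]
    · simp only [map_add, smul_add, Finset.sum_add_distrib]
      rw [hK2 n m J (by omega), hM2 n m J (by omega)]
      abel
  | mul_X f k hf =>
    obtain ⟨K, hK1, hK2⟩ := hf
    -- The product with p_k also involves `delRow (n - k) f`, so the bound grows by k.
    refine ⟨K + k, fun n hn => ?_, fun n m J hJ => ?_⟩
    · rw [delRow_mul_X, hK1 n (by omega), hK1 (n - k) (by omega), zero_mul, add_zero]
    · have h1 : ∀ j : ℕ, swapCoeff j • addRow (m + j) (delRow (n + j) (f * MvPolynomial.X k)) =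
          (swapCoeff j • addRow (m + j) (delRow (n + j) f)) * MvPolynomial.X k -
            swapCoeff j • addRow (m + k + j) (delRow (n + j) f) +
            swapCoeff j • addRow (m + j) (delRow (n - k + j) f) := by
        intro j
        rw [delRow_mul_X, map_add, addRow_mul_X, smul_add, smul_sub, smul_mul_assoc,
          add_right_comm m, add_sub_right_comm n]
      simp only [h1, Finset.sum_add_distrib, Finset.sum_sub_distrib, ← Finset.sum_mul]
      rw [addRow_mul_X, map_sub, delRow_mul_X, hK2 n m J (by omega), hK2 (n - k) m J (by omega),
        hK2 n (m + k) J (by omega), add_mul, smul_mul_assoc]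
      -- The conditions n - k = m and n = m + k agree, so the two extra delta terms cancel.
      simp only [sub_eq_iff_eq_add (a := n)]
      abel

theorem delRow_addRow_eq_zero {v : Lam} {n m : ℤ} (h : n ≠ m)
    (hv : ∀ j : ℕ, delRow (n + j) v = 0) : delRow n (addRow m v) = 0 := by
  obtain ⟨K, -, hK⟩ := exists_delRow_addRow v
  rw [hK n m (K - n).toNat (by omega), if_neg h, zero_smul, zero_add]
  exact Finset.sum_eq_zero fun j _ => by rw [hv, map_zero, smul_zero]

theorem delRow_addRow_self {v : Lam} {m : ℤ} (hv : ∀ j : ℕ, j ≠ 0 → delRow (m + j) v = 0) :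
    delRow m (addRow m v) = (1 - t) • v + t • addRow m (delRow m v) := by
  obtain ⟨K, -, hK⟩ := exists_delRow_addRow v
  rw [hK m m ((K - m).toNat + 1) (by omega), if_pos rfl, Finset.sum_eq_single 0]
  · simp [swapCoeff]
  · intro j _ hj
    rw [hv j hj, map_zero, smul_zero]
  · simp

theorem apply_delRow_addRow_eq_zero {ψ : Lam →ₗ[F] F} {n m : ℤ} (h : n ≠ m)
    (hψ : ∀ (j : ℕ) (v : Lam), ψ (addRow (m + j) v) = 0) (f : Lam) :
    ψ (delRow n (addRow m f)) = 0 := by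
  obtain ⟨K, -, hK⟩ := exists_delRow_addRow f
  rw [hK n m (K - n).toNat (by omega), if_neg h, zero_smul, zero_add, map_sum]
  exact Finset.sum_eq_zero fun j _ => by rw [map_smul, hψ, smul_zero]

/-! ### Duality of row removal and Hall-Littlewood functions. -/

/-- The Hall-Littlewood function `Q_L` in abstract power sums. -/
def qHat : List ℕ → Lam
  | [] => 1
  | m :: L => addRow m (qHat L)

/-- The functional removing the rows `L_1, L_2, …` and taking the constant coefficient. -/
def green : List ℕ → Lam →ₗ[F] F
  | [] => MvPolynomial.lcoeff F 0
  | k :: L => green L ∘ₗ delRow k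

theorem green_cons (k : ℕ) (L : List ℕ) (f : Lam) :
    green (k :: L) f = green L (delRow k f) := rfl

theorem constantCoeff_hz (w : ℕ → F) {a : ℤ} (ha : a ≠ 0) :
    MvPolynomial.constantCoeff (hz w a) = 0 := by
  by_cases h : a < 0
  · rw [hz_of_neg w h, map_zero]
  obtain ⟨a, rfl⟩ := Int.eq_ofNat_of_zero_le (not_lt.1 h)
  rw [hz_natCast, hsum, map_sum]
  refine Finset.sum_eq_zero fun ρ hρ => ?_
  obtain ⟨i, hi⟩ : ∃ i, i ∈ ρ := by
    refine Multiset.exists_mem_of_ne_zero ?_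
    rintro rfl
    have := (mem_partsOf.1 hρ).2
    simp at this
    omega
  rw [MvPolynomial.constantCoeff_smul, map_multiset_prod, Multiset.prod_eq_zero, smul_zero]
  simp only [Multiset.map_map, Function.comp_apply, MvPolynomial.constantCoeff_smul,
    MvPolynomial.constantCoeff_X, smul_zero, Multiset.mem_map, and_true]
  exact ⟨i, hi⟩

theorem constantCoeff_addRow {m : ℤ} (hm : 0 < m) (f : Lam) :
    MvPolynomial.constantCoeff (addRow m f) = 0 := by
  rw [addRow, vertex_apply]
  induction shift (-1) f using Polynomial.induction_on' with
  | add p q hp hq => rw [map_add, map_add, hp, hq, add_zero]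
  | monomial j p => rw [readOff_monomial, map_mul, constantCoeff_hz _ (by omega), mul_zero]

/-- Moving `delRow n` past the rows of L never lowers its index, so no delta term appears; at the
end it meets 1 and gives e_{-n} = 0. -/
theorem delRow_qHat {L : List ℕ} (hL : L.Pairwise (· ≥ ·)) {n : ℤ} (hn : 0 < n)
    (h : ∀ a ∈ L, (a : ℤ) < n) : delRow n (qHat L) = 0 := by
  induction L generalizing n with
  | nil => rw [qHat, delRow_one, hz_of_neg _ (by omega)]
  | cons m L ih =>
    rw [List.pairwise_cons] at hL
    have hm := h m List.mem_cons_self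
    refine delRow_addRow_eq_zero hm.ne' fun j => ih hL.2 (by omega) fun a ha => ?_
    have := hL.1 a ha
    omega

/-- The mirror image: the added row moves out past the removals with nondecreasing index, and a row
of positive length has no constant term. -/
theorem green_addRow {L : List ℕ} (hL : L.Pairwise (· ≥ ·)) {m : ℤ} (hm : 0 < m)
    (h : ∀ a ∈ L, (a : ℤ) < m) (f : Lam) : green L (addRow m f) = 0 := by
  induction L generalizing m f with
  | nil => exact constantCoeff_addRow hm f
  | cons k L ih =>
    rw [List.pairwise_cons] at hL
    have hk := h k List.mem_cons_self
    rw [green_cons]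
    refine apply_delRow_addRow_eq_zero hk.ne (fun j v => ih hL.2 (by omega) (fun a ha => ?_) v) f
    have := hL.1 a ha
    omega

/-- Each row of L equal to m contributes one step of (1 - t) + t (1 - t^c) = 1 - t^{c+1}. These are
the factors of b_λ(t), see `b_cons`. -/
theorem delRow_qHat_cons_self {m : ℕ} {L : List ℕ} (hm : 0 < m)
    (hL : (m :: L).Pairwise (· ≥ ·)) :
    delRow m (qHat (m :: L)) = (1 - t ^ (L.count m + 1)) • qHat L := by
  have hz : ∀ j : ℕ, j ≠ 0 → delRow ((m : ℤ) + j) (qHat L) = 0 := by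
    rw [List.pairwise_cons] at hL
    intro j hj
    refine delRow_qHat hL.2 (by omega) fun a ha => ?_
    have := hL.1 a ha
    omega
  rw [qHat, delRow_addRow_self hz]
  induction L with
  | nil => rw [qHat, delRow_one, hz_of_neg _ (by omega)]; simp
  | cons m' L ih =>
    have hL' := hL
    rw [List.pairwise_cons] at hL
    by_cases hmm : m' = m
    · subst hmm
      have hz' : ∀ j : ℕ, j ≠ 0 → delRow ((m' : ℤ) + j) (qHat L) = 0 := by
        have hL2 := hL.2
        rw [List.pairwise_cons] at hL2
        intro j hj
        refine delRow_qHat hL2.2 (by omega) fun a ha => ?_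
        have := hL2.1 a ha
        omega
      conv_lhs => enter [2, 2, 2]; rw [qHat, delRow_addRow_self hz', ih hL.2 hz']
      rw [map_smul, List.count_cons_self, qHat, smul_smul, ← add_smul]
      congr 1
      ring
    · have hlt : m' < m := lt_of_le_of_ne (hL.1 m' List.mem_cons_self) hmm
      have hlt' : ∀ a ∈ m' :: L, (a : ℤ) < m := by
        intro a ha
        rcases List.mem_cons.1 ha with rfl | ha
        · omega
        · have := (List.pairwise_cons.1 hL.2).1 a ha
          omega
      rw [delRow_qHat hL.2 (by omega) hlt', map_zero, smul_zero, add_zero,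
        List.count_eq_zero_of_not_mem fun hmem => lt_irrefl _ (hlt' m hmem)]
      simp

theorem b_cons (k : ℕ) (ρ : Multiset ℕ) : b (k ::ₘ ρ) = (1 - t ^ (ρ.count k + 1)) * b ρ := by
  have hb : ∀ (σ : Multiset ℕ) {s : Finset ℕ}, σ.toFinset ⊆ s →
      b σ = ∏ i ∈ s, ∏ j ∈ Finset.Icc 1 (σ.count i), (1 - t ^ j) := by
    intro σ s hs
    refine Finset.prod_subset hs fun i _ hi => ?_
    rw [Multiset.mem_toFinset] at hi
    simp [Multiset.count_eq_zero_of_notMem hi]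
  have hk : k ∈ insert k ρ.toFinset := Finset.mem_insert_self _ _
  rw [hb (k ::ₘ ρ) (s := insert k ρ.toFinset) (by simp),
    hb ρ (s := insert k ρ.toFinset) (by simp), ← Finset.mul_prod_erase _ _ hk,
    ← Finset.mul_prod_erase _ _ hk, Multiset.count_cons_self,
    Finset.prod_Icc_succ_top (by omega), mul_comm (∏ j ∈ _, _), mul_assoc]
  congr 2
  refine Finset.prod_congr rfl fun i hi => ?_
  rw [Multiset.count_cons_of_ne (Finset.ne_of_mem_erase hi)]

/-- Compare first rows: if they differ, the longer one annihilates (`green_addRow` or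
`delRow_qHat`); if they agree, removing it leaves a scalar and shorter lists. -/
theorem green_qHat {K L : List ℕ} (hK : K.Pairwise (· ≥ ·)) (hL : L.Pairwise (· ≥ ·))
    (hK0 : ∀ a ∈ K, 0 < a) (hL0 : ∀ a ∈ L, 0 < a) :
    green K (qHat L) = if K = L then b (L : Multiset ℕ) else 0 := by
  induction K generalizing L with
  | nil =>
    cases L with
    | nil => simp [green, qHat, b]
    | cons m L =>
      rw [if_neg (by simp)]
      exact green_addRow hK (by exact_mod_cast hL0 m List.mem_cons_self) (by simp) _
  | cons k K ih =>
    cases L with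
    | nil =>
      rw [if_neg (by simp), green_cons, delRow_qHat hL (by exact_mod_cast hK0 k List.mem_cons_self)
        (by simp), map_zero]
    | cons m L =>
      have hK1 := List.pairwise_cons.1 hK
      have hL1 := List.pairwise_cons.1 hL
      have hk := hK0 k List.mem_cons_self
      have hm := hL0 m List.mem_cons_self
      rcases lt_trichotomy k m with h | rfl | h
      · rw [if_neg (by simp [h.ne])]
        refine green_addRow hK (by omega) (fun a ha => ?_) _
        rcases List.mem_cons.1 ha with rfl | ha
        · omega
        · have := hK1.1 a ha
          omega
      · rw [green_cons, delRow_qHat_cons_self hk hL, map_smul, ih hK1.2 hL1.2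
          (fun a ha => hK0 a (List.mem_cons_of_mem _ ha))
          (fun a ha => hL0 a (List.mem_cons_of_mem _ ha))]
        by_cases hKL : K = L
        · simp [hKL, ← Multiset.cons_coe, b_cons]
        · simp [hKL]
      · rw [if_neg (by simp [h.ne']), green_cons, delRow_qHat hL (by omega), map_zero]
        intro a ha
        rcases List.mem_cons.1 ha with rfl | ha
        · omega
        · have := hL1.1 a ha
          omega

/-! ### Comparison with the raising operator definition. -/

theorem prod_map_smul_X (w : ℕ → F) (ρ : Multiset ℕ) :
    (ρ.map fun n => w n • (MvPolynomial.X n : Lam)).prod = (ρ.map w).prod • pMon ρ := by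
  induction ρ using Multiset.induction_on with
  | empty => simp [pMon]
  | cons k ρ ih =>
    rw [Multiset.map_cons, Multiset.prod_cons, ih, smul_mul_smul_comm, Multiset.map_cons,
      Multiset.prod_cons, pMon, pMon, Multiset.map_cons, Multiset.prod_cons]

theorem hz_eq_sum (w : ℕ → F) (a : ℕ) :
    hz w a = ∑ ρ ∈ partsOf a, ((z ρ : F)⁻¹ * (ρ.map w).prod) • pMon ρ := by
  rw [hz_natCast, hsum]
  exact Finset.sum_congr rfl fun ρ _ => by rw [prod_map_smul_X, smul_smul]

theorem inv_zt (ρ : Multiset ℕ) : (zt ρ)⁻¹ = (z ρ : F)⁻¹ * (ρ.map qWeight).prod := by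
  rw [zt, inv_div, div_eq_inv_mul]
  rfl

/-- The evaluation of abstract power sums at the power sums. -/
def evalPsum : Lam →ₐ[F] Ser := MvPolynomial.aeval psum

theorem evalPsum_pMon (ρ : Multiset ℕ) : evalPsum (pMon ρ) = psumPart ρ := by
  rw [pMon, map_multiset_prod, Multiset.map_map, psumPart]
  congr 2
  ext1 n
  exact MvPolynomial.aeval_X _ _

theorem evalPsum_hz (a : ℤ) : evalPsum (hz qWeight a) = q a := by
  by_cases ha : a < 0
  · rw [hz_of_neg _ ha, map_zero, q, if_neg (not_le.2 ha)]
  obtain ⟨a, rfl⟩ := Int.eq_ofNat_of_zero_le (not_lt.1 ha)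
  rw [hz_eq_sum, map_sum, q, if_pos (by omega), sum_partsOf]
  simp only [map_smul, evalPsum_pMon, inv_zt]
  rfl

/-- j_a is the exponent of the operator raising the new row at the expense of row a. -/
theorem addRow_prod_hz {l : ℕ} (m : ℤ) (r : Fin l → ℤ) {N : ℕ} (hr : ∀ a, r a < N) :
    addRow m (∏ a, hz qWeight (r a)) =
      ∑ j ∈ Fintype.piFinset fun _ : Fin l => Finset.range N, (∏ a, raisingCoeff (j a)) •
        (hz qWeight (m + ∑ a, (j a : ℤ)) * ∏ a, hz qWeight (r a - j a)) := by
  rw [addRow, vertex_apply, map_prod]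
  simp only [fun a => shift_hz (-1) qWeight (hr a)]
  rw [Finset.prod_univ_sum, map_sum]
  refine Finset.sum_congr rfl fun j _ => ?_
  have h : (fun n => -1 * qWeight n) = fun n => -(1 - t ^ n) := by
    ext1 n
    rw [neg_one_mul, qWeight]
  simp only [h, hsum_neg_one_sub_t_pow]
  rw [Finset.prod_smul, Finset.prod_mul_distrib, Finset.prod_pow_eq_pow_sum, ← map_prod,
    LinearMap.map_smul_of_tower, readOff_X_pow_mul, ← mul_one (Polynomial.C _), readOff_C_mul,
    ← Polynomial.monomial_zero_one, readOff_monomial, one_mul, mul_comm]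
  simp

/-- The pairs in `{0, …, l}` are those containing `0` and the shifted pairs in `{0, …, l - 1}`. -/
def pairsSucc (l : ℕ) : Fin l ⊕ Pairs l → Pairs (l + 1) :=
  Sum.elim (fun j => ⟨(0, j.succ), Fin.succ_pos j⟩)
    fun p => ⟨(p.1.1.succ, p.1.2.succ), Fin.succ_lt_succ_iff.2 p.2⟩

theorem pairsSucc_bijective (l : ℕ) : Function.Bijective (pairsSucc l) := by
  constructor
  · rintro (i | ⟨⟨i, i'⟩, hi⟩) (j | ⟨⟨j, j'⟩, hj⟩) h
    all_goals simp [pairsSucc, Fin.ext_iff] at h ⊢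
    all_goals omega
  · rintro ⟨⟨i, j⟩, h⟩
    induction j using Fin.cases with
    | zero => exact absurd h (Fin.not_lt_zero i)
    | succ j =>
      induction i using Fin.cases with
      | zero => exact ⟨Sum.inl j, rfl⟩
      | succ i => exact ⟨Sum.inr ⟨(i, j), Fin.succ_lt_succ_iff.1 h⟩, rfl⟩

/-- The bijection `pairsSucc` as an equivalence. -/
def pairsEquiv (l : ℕ) : Fin l ⊕ Pairs l ≃ Pairs (l + 1) :=
  Equiv.ofBijective _ (pairsSucc_bijective l)

/-- Exponents for the pairs in `{0, …, l}` from those for the two kinds of pairs. -/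
def joinExp {l : ℕ} (j : Fin l → ℕ) (m : Pairs l → ℕ) (p : Pairs (l + 1)) : ℕ :=
  Sum.elim j m ((pairsEquiv l).symm p)

theorem joinExp_pairsSucc {l : ℕ} (j : Fin l → ℕ) (m : Pairs l → ℕ) (s : Fin l ⊕ Pairs l) :
    joinExp j m (pairsSucc l s) = Sum.elim j m s := by
  rw [joinExp, show pairsSucc l s = pairsEquiv l s from rfl, Equiv.symm_apply_apply]

theorem sum_box_pairs_succ {M : Type*} [AddCommMonoid M] (l N : ℕ) (f : (Pairs (l + 1) → ℕ) → M) :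
    ∑ m ∈ Fintype.piFinset fun _ : Pairs (l + 1) => Finset.range N, f m =
      ∑ m ∈ Fintype.piFinset fun _ : Pairs l => Finset.range N,
        ∑ j ∈ Fintype.piFinset fun _ : Fin l => Finset.range N, f (joinExp j m) := by
  rw [Finset.sum_sigma']
  symm
  refine Finset.sum_bij' (fun q _ => joinExp q.2 q.1)
    (fun m _ => ⟨fun p => m (pairsSucc l (Sum.inr p)), fun a => m (pairsSucc l (Sum.inl a))⟩)
    ?_ ?_ ?_ ?_ ?_
  · rintro ⟨m, j⟩ h
    simp only [Finset.mem_sigma, Fintype.mem_piFinset] at h ⊢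
    intro p
    obtain ⟨s, rfl⟩ := (pairsSucc_bijective l).2 p
    rw [joinExp_pairsSucc]
    cases s with
    | inl a => exact h.2 a
    | inr p => exact h.1 p
  · intro m h
    simp only [Finset.mem_sigma, Fintype.mem_piFinset] at h ⊢
    exact ⟨fun p => h _, fun p => h _⟩
  · rintro ⟨m, j⟩ h
    simp [joinExp_pairsSucc]
  · intro m h
    ext1 p
    obtain ⟨s, rfl⟩ := (pairsSucc_bijective l).2 p
    rw [joinExp_pairsSucc]
    cases s <;> rfl
  · intro _ _
    rfl

theorem prod_joinExp {l : ℕ} (j : Fin l → ℕ) (m : Pairs l → ℕ) (f : ℕ → F) :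
    ∏ p, f (joinExp j m p) = (∏ a, f (j a)) * ∏ p, f (m p) := by
  rw [← (pairsEquiv l).prod_comp, Fintype.prod_sum_type]
  simp [joinExp]

theorem raise_cons_zero (k : ℕ) (L : List ℕ) (j : Fin L.length → ℕ) (m : Pairs L.length → ℕ) :
    raise (k :: L) (joinExp j m) (0 : Fin (L.length + 1)) = k + ∑ a, (j a : ℤ) := by
  rw [raise]
  congr 1
  change ∑ p : Pairs (L.length + 1), _ = _
  rw [← (pairsEquiv L.length).sum_comp, Fintype.sum_sum_type]
  have h1 : ∀ s, pairsEquiv L.length s = pairsSucc L.length s := fun s => rfl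
  simp only [h1, joinExp_pairsSucc]
  simp [pairsSucc, Fin.succ_ne_zero]

theorem raise_cons_succ (k : ℕ) (L : List ℕ) (j : Fin L.length → ℕ) (m : Pairs L.length → ℕ)
    (a : Fin L.length) :
    raise (k :: L) (joinExp j m) (a.succ : Fin (L.length + 1)) = raise L m a - j a := by
  rw [raise, raise, add_sub_assoc]
  congr 1
  change ∑ p : Pairs (L.length + 1), _ = _
  rw [← (pairsEquiv L.length).sum_comp, Fintype.sum_sum_type]
  have h1 : ∀ s, pairsEquiv L.length s = pairsSucc L.length s := fun s => rfl
  simp only [h1, joinExp_pairsSucc]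
  simp [pairsSucc, (Fin.succ_ne_zero _).symm]
  ring

theorem sum_raise (L : List ℕ) (m : Pairs L.length → ℕ) : ∑ a, raise L m a = L.sum := by
  simp only [raise, Finset.sum_add_distrib]
  rw [Finset.sum_comm]
  simp only [Finset.sum_sub_distrib, Finset.sum_ite_eq, Finset.mem_univ, if_true, sub_self]
  simp [← Nat.cast_sum, Fin.sum_univ_getElem]

theorem qHat_eq_sum_box (L : List ℕ) {N : ℕ} (hN : L.sum < N) :
    qHat L = ∑ m ∈ Fintype.piFinset fun _ : Pairs L.length => Finset.range N,
      (∏ p, raisingCoeff (m p)) • ∏ a, hz qWeight (raise L m a) := by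
  induction L with
  | nil =>
    have : IsEmpty (Pairs ([] : List ℕ).length) := ⟨fun p => p.1.1.elim0⟩
    simp [qHat]
  | cons k L ih =>
    rw [List.sum_cons] at hN
    rw [qHat, ih (by omega), map_sum]
    change _ = ∑ m ∈ Fintype.piFinset fun _ : Pairs (L.length + 1) => Finset.range N, _
    rw [sum_box_pairs_succ]
    refine Finset.sum_congr rfl fun m _ => ?_
    have h1 : ∀ j : Fin L.length → ℕ, (∏ p, raisingCoeff (joinExp j m p)) •
        ∏ a, hz qWeight (raise (k :: L) (joinExp j m) a) =
        (∏ p, raisingCoeff (m p)) • (∏ a, raisingCoeff (j a)) •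
        (hz qWeight (k + ∑ a, (j a : ℤ)) * ∏ a, hz qWeight (raise L m a - j a)) := by
      intro j
      change _ • ∏ a : Fin (L.length + 1), _ = _
      rw [prod_joinExp, mul_comm, smul_smul, Fin.prod_univ_succ, raise_cons_zero]
      simp only [raise_cons_succ]
    rw [map_smul]
    refine Eq.trans ?_ (Finset.sum_congr rfl fun j _ => (h1 j).symm)
    rw [← Finset.smul_sum]
    congr 1
    by_cases hr : ∀ a, raise L m a < N
    · exact addRow_prod_hz k _ hr
    -- An entry ≥ N exceeds the total `L.sum`, so another entry is negative and both sides vanish.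
    · push Not at hr
      obtain ⟨a, ha⟩ := hr
      obtain ⟨c, hc⟩ : ∃ c, raise L m c < 0 := by
        by_contra! hnn
        have h2 := sum_raise L m
        have h3 := Finset.single_le_sum (fun c _ => hnn c) (Finset.mem_univ a)
        omega
      rw [Finset.prod_eq_zero (Finset.mem_univ c) (hz_of_neg _ hc), map_zero,
        Finset.sum_eq_zero]
      intro j _
      have h4 : ∏ a, hz qWeight (raise L m a - j a) = 0 :=
        Finset.prod_eq_zero (Finset.mem_univ c) (hz_of_neg _ (by omega))
      rw [h4, mul_zero, smul_zero]

theorem evalPsum_qHat (L : List ℕ) : evalPsum (qHat L) = hallQ L := by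
  obtain ⟨B, hB⟩ := (finite_support_raisingTerm L).bddAbove
  -- N exceeds `L.sum` and every exponent occurring in the support of `raisingTerm L`.
  set N := L.sum + 1 + ∑ p, (B p + 1) with hN
  rw [qHat_eq_sum_box L (N := N) (by omega), map_sum, hallQ, finsum_eq_sum_of_support_subset
    (s := Fintype.piFinset fun _ : Pairs L.length => Finset.range N)]
  · refine Finset.sum_congr rfl fun m _ => ?_
    rw [map_smul, map_prod, raisingTerm]
    simp only [evalPsum_hz]
  · intro m hm
    simp only [Finset.mem_coe, Fintype.mem_piFinset, Finset.mem_range]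
    intro p
    have h1 := hB hm p
    have h2 := Finset.single_le_sum (f := fun p => B p + 1) (fun _ _ => Nat.zero_le _)
      (Finset.mem_univ p)
    have h3 : m p ≤ B p := h1
    omega

/-! ### Linear independence of the products p_μ. -/

open Classical in
/-- The power sum over the natural numbers. -/
def natPsum (n : ℕ) : MvPowerSeries ℕ ℕ :=
  fun m => if ∃ i, m = Finsupp.single i n then 1 else 0

/-- The product of power sums over the natural numbers. -/
def natPsumPart (ρ : Multiset ℕ) : MvPowerSeries ℕ ℕ := (ρ.map natPsum).prod

theorem natPsumPart_cons (k : ℕ) (ρ : Multiset ℕ) :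
    natPsumPart (k ::ₘ ρ) = natPsum k * natPsumPart ρ := by
  rw [natPsumPart, Multiset.map_cons, Multiset.prod_cons, natPsumPart]

theorem map_natPsumPart (ρ : Multiset ℕ) :
    MvPowerSeries.map (Nat.castRingHom F) (natPsumPart ρ) = psumPart ρ := by
  rw [natPsumPart, map_multiset_prod, Multiset.map_map, psumPart]
  congr 2
  ext1 n
  ext m
  rw [Function.comp_apply, MvPowerSeries.coeff_map]
  by_cases h : ∃ i, m = Finsupp.single i n
  · exact (congrArg _ (if_pos h)).trans ((Nat.cast_one (R := F)).trans (if_pos h).symm)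
  · exact (congrArg _ (if_neg h)).trans ((Nat.cast_zero (R := F)).trans (if_neg h).symm)

theorem coeff_psumPart (ρ : Multiset ℕ) (e : ℕ →₀ ℕ) :
    MvPowerSeries.coeff e (psumPart ρ) = ((MvPowerSeries.coeff e (natPsumPart ρ) : ℕ) : F) := by
  rw [← map_natPsumPart, MvPowerSeries.coeff_map]
  rfl

/-- The multiset of nonzero exponents of a monomial. -/
def expParts (e : ℕ →₀ ℕ) : Multiset ℕ := e.support.val.map e

theorem card_expParts (e : ℕ →₀ ℕ) : (expParts e).card = e.support.card :=
  Multiset.card_map _ _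

theorem expParts_single_add {i k : ℕ} {e : ℕ →₀ ℕ} (hk : k ≠ 0) (hi : i ∉ e.support) :
    expParts (Finsupp.single i k + e) = k ::ₘ expParts e := by
  have h1 : (Finsupp.single i k + e).support = Finset.cons i e.support hi := by
    ext j
    rw [Finsupp.notMem_support_iff] at hi
    simp only [Finsupp.mem_support_iff, Finsupp.add_apply, Finset.mem_cons, ne_eq]
    by_cases hj : j = i
    · subst hj
      simp [hk]
    · simp [hj]
  rw [expParts, h1, Finset.cons_val, Multiset.map_cons]
  congr 1
  · simp [Finsupp.notMem_support_iff.1 hi]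
  · refine Multiset.map_congr rfl fun j hj => ?_
    have : j ≠ i := by
      rintro rfl
      exact hi hj
    simp [this.symm]

/-- Multiplying by p_k either introduces a new variable with exponent k or merges into an old one.
Only without merging is the number of variables l(ρ), and then the exponents are the parts. -/
theorem expParts_of_coeff_ne_zero {ρ : Multiset ℕ} (hρ : ∀ i ∈ ρ, 0 < i) {e : ℕ →₀ ℕ}
    (h : MvPowerSeries.coeff e (natPsumPart ρ) ≠ 0) :
    e.support.card ≤ ρ.card ∧ (e.support.card = ρ.card → expParts e = ρ) := by
  classical
  induction ρ using Multiset.induction_on generalizing e with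
  | empty =>
    rw [natPsumPart, Multiset.map_zero, Multiset.prod_zero, MvPowerSeries.coeff_one] at h
    have he : e = 0 := by
      by_contra he
      simp [he] at h
    simp [he, expParts]
  | cons k ρ ih =>
    rw [natPsumPart_cons, MvPowerSeries.coeff_mul] at h
    obtain ⟨⟨e₁, e₂⟩, he, h⟩ := Finset.exists_ne_zero_of_sum_ne_zero h
    rw [Finset.HasAntidiagonal.mem_antidiagonal] at he
    obtain ⟨i, rfl⟩ : ∃ i, e₁ = Finsupp.single i k := by
      by_contra hi
      exact left_ne_zero_of_mul h (if_neg hi)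
    obtain ⟨h1, h2⟩ := ih (fun i hi => hρ i (Multiset.mem_cons_of_mem hi)) (right_ne_zero_of_mul h)
    have hk := (hρ k (Multiset.mem_cons_self k ρ)).ne'
    simp only at he h1 h2
    subst he
    rw [Multiset.card_cons]
    by_cases hi : i ∈ e₂.support
    · have h3 : (Finsupp.single i k + e₂).support ⊆ e₂.support := by
        refine Finsupp.support_add.trans (Finset.union_subset ?_ subset_rfl)
        refine Finsupp.support_single_subset.trans ?_
        simpa using hi
      have h4 := Finset.card_le_card h3
      exact ⟨by omega, by omega⟩
    · rw [← card_expParts, expParts_single_add hk hi, Multiset.card_cons, card_expParts]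
      exact ⟨by omega, fun h5 => by rw [h2 (by omega)]⟩

theorem exists_coeff_ne_zero {ρ : Multiset ℕ} (hρ : ∀ i ∈ ρ, 0 < i) :
    ∃ e : ℕ →₀ ℕ, expParts e = ρ ∧ MvPowerSeries.coeff e (natPsumPart ρ) ≠ 0 := by
  classical
  induction ρ using Multiset.induction_on with
  | empty => exact ⟨0, by simp [expParts], by simp [natPsumPart]⟩
  | cons k ρ ih =>
    obtain ⟨e, he, h⟩ := ih fun i hi => hρ i (Multiset.mem_cons_of_mem hi)
    obtain ⟨i, hi⟩ := Infinite.exists_notMem_finset e.support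
    refine ⟨Finsupp.single i k + e, ?_, ?_⟩
    · rw [expParts_single_add (hρ k (Multiset.mem_cons_self k ρ)).ne' hi, he]
    · rw [natPsumPart_cons, MvPowerSeries.coeff_mul]
      intro h0
      -- Over ℕ nothing cancels: the sum vanishes only if each term does.
      rw [Finset.sum_eq_zero_iff] at h0
      have h1 := h0 (Finsupp.single i k, e) (by rw [Finset.HasAntidiagonal.mem_antidiagonal])
      refine mul_ne_zero ?_ h h1
      have h2 : MvPowerSeries.coeff (Finsupp.single i k) (natPsum k) = 1 := if_pos ⟨i, rfl⟩
      rw [h2]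
      exact one_ne_zero

theorem linearIndependent_psumPart (n : ℕ) :
    LinearIndependent F fun mu : n.Partition => psumPart mu.parts := by
  classical
  rw [Fintype.linearIndependent_iff]
  intro g hg
  by_contra! hne
  obtain ⟨mu₀, hmu₀⟩ := hne
  -- For μ of maximal length in the relation, a monomial with exponents μ, in distinct variables,
  -- occurs in no other p_ν of the relation.
  obtain ⟨mu, hmu, hmax⟩ := Finset.exists_max_image
    (Finset.univ.filter fun mu : n.Partition => g mu ≠ 0) (fun mu => mu.parts.card)
    ⟨mu₀, by simpa using hmu₀⟩
  obtain ⟨e, he, hc⟩ := exists_coeff_ne_zero fun _ hi => mu.parts_pos hi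
  have h1 := congrArg (MvPowerSeries.coeff e) hg
  rw [map_sum, map_zero, Finset.sum_eq_single mu] at h1
  · rw [MvPowerSeries.coeff_smul, coeff_psumPart, mul_eq_zero, Nat.cast_eq_zero] at h1
    rw [Finset.mem_filter] at hmu
    exact h1.elim hmu.2 hc
  · intro nu _ hnu
    rw [MvPowerSeries.coeff_smul, coeff_psumPart]
    by_contra h2
    have h3 := hmax nu (by simpa using left_ne_zero_of_mul h2)
    obtain ⟨h4, h5⟩ := expParts_of_coeff_ne_zero (fun _ hi => nu.parts_pos hi)
      ((Nat.cast_ne_zero (R := F)).1 (right_ne_zero_of_mul h2))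
    rw [← card_expParts, he] at h4 h5
    refine hnu (Nat.Partition.ext ?_)
    rw [← h5 (by omega)]
  · simp

/-! ### Existence and uniqueness of the coefficients X^λ_μ. -/

/-- The span of the monomials `p_μ` with `μ ⊢ n`. -/
def pSpan (n : ℕ) : Submodule F Lam :=
  Submodule.span F (Set.range fun mu : n.Partition => pMon mu.parts)

theorem pMon_mem_pSpan {n : ℕ} {ρ : Multiset ℕ} (hρ : ρ ∈ partsOf n) : pMon ρ ∈ pSpan n := by
  obtain ⟨mu, -, rfl⟩ := Finset.mem_image.1 hρ
  exact Submodule.subset_span ⟨mu, rfl⟩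

theorem mul_mem_pSpan {m n : ℕ} {f g : Lam} (hf : f ∈ pSpan m) (hg : g ∈ pSpan n) :
    f * g ∈ pSpan (m + n) := by
  have h := Submodule.mul_mem_mul hf hg
  rw [pSpan, pSpan, Submodule.span_mul_span] at h
  refine Submodule.span_le.2 ?_ h
  rintro _ ⟨_, ⟨mu, rfl⟩, _, ⟨nu, rfl⟩, rfl⟩
  have h1 : pMon mu.parts * pMon nu.parts = pMon (mu.parts + nu.parts) := by
    simp [pMon]
  simp only [h1]
  refine pMon_mem_pSpan (mem_partsOf.2 ⟨fun i hi => ?_, ?_⟩)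
  · rcases Multiset.mem_add.1 hi with hi | hi
    · exact mu.parts_pos hi
    · exact nu.parts_pos hi
  · rw [Multiset.sum_add, mu.parts_sum, nu.parts_sum]

theorem hz_mem_pSpan (w : ℕ → F) (a : ℕ) : hz w a ∈ pSpan a := by
  rw [hz_eq_sum]
  exact Submodule.sum_mem _ fun ρ hρ => Submodule.smul_mem _ _ (pMon_mem_pSpan hρ)

theorem prod_hz_mem_pSpan {ι : Type*} (s : Finset ι) (w : ℕ → F) (r : ι → ℕ) :
    ∏ i ∈ s, hz w (r i) ∈ pSpan (∑ i ∈ s, r i) := by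
  classical
  induction s using Finset.induction_on with
  | empty => exact pMon_mem_pSpan (ρ := 0) (mem_partsOf.2 (by simp))
  | insert i s hi ih =>
    rw [Finset.prod_insert hi, Finset.sum_insert hi]
    exact mul_mem_pSpan (hz_mem_pSpan w _) ih

theorem qHat_mem_pSpan (L : List ℕ) : qHat L ∈ pSpan L.sum := by
  rw [qHat_eq_sum_box L (Nat.lt_succ_self _)]
  refine Submodule.sum_mem _ fun m _ => Submodule.smul_mem _ _ ?_
  by_cases h : ∀ a, 0 ≤ raise L m a
  · choose r hr using fun a => Int.eq_ofNat_of_zero_le (h a)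
    have h1 := sum_raise L m
    simp only [hr] at h1 ⊢
    rw [← Nat.cast_sum] at h1
    rw [← Nat.cast_inj.1 h1]
    exact prod_hz_mem_pSpan _ _ _
  · push Not at h
    obtain ⟨a, ha⟩ := h
    rw [Finset.prod_eq_zero (Finset.mem_univ a) (hz_of_neg _ ha)]
    exact Submodule.zero_mem _

theorem one_sub_t_pow_ne_zero {j : ℕ} (hj : 0 < j) : (1 - t ^ j : F) ≠ 0 := by
  have h : (1 - t ^ j : F) = algebraMap (Polynomial ℚ) F (1 - Polynomial.X ^ j) := by
    simp [t]
  rw [h, Ne, map_eq_zero_iff _ (RatFunc.algebraMap_injective ℚ)]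
  intro h0
  have := congrArg (Polynomial.eval 0) h0
  simp [hj.ne'] at this

theorem b_ne_zero (lam : Multiset ℕ) : b lam ≠ 0 :=
  Finset.prod_ne_zero_iff.2 fun _ _ => Finset.prod_ne_zero_iff.2 fun _ hj =>
    one_sub_t_pow_ne_zero (Finset.mem_Icc.1 hj).1

/-- The parts of a partition in decreasing order. -/
def rows (lam : Multiset ℕ) : List ℕ := lam.sort (· ≥ ·)

theorem coe_rows (lam : Multiset ℕ) : (rows lam : Multiset ℕ) = lam := Multiset.sort_eq _ _

theorem rows_pairwise (lam : Multiset ℕ) : (rows lam).Pairwise (· ≥ ·) :=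
  Multiset.pairwise_sort _ _

theorem rows_eq {lam : Multiset ℕ} {L : List ℕ} (h : (L : Multiset ℕ) = lam)
    (hL : L.Pairwise (· ≥ ·)) : rows lam = L := by
  refine List.Perm.eq_of_pairwise' (rows_pairwise lam) hL ?_
  rw [← Multiset.coe_eq_coe, coe_rows, h]

theorem rows_injective : Function.Injective rows := fun a b h => by
  rw [← coe_rows a, h, coe_rows]

/-- The Green functions exist and are unique: they are the values of the functionals `green`. -/
theorem isGreen_green_and_unique (n : ℕ) :
    IsGreen n (fun lam mu => green (rows lam.parts) (pMon mu.parts)) ∧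
    ∀ X, IsGreen n X → X = fun lam mu => green (rows lam.parts) (pMon mu.parts) := by
  classical
  have h1 : ∀ kap : n.Partition, ∃ c : n.Partition → F,
      ∑ mu, c mu • pMon mu.parts = qHat (rows kap.parts) := by
    intro kap
    have h := qHat_mem_pSpan (rows kap.parts)
    rw [← Multiset.sum_coe, coe_rows, kap.parts_sum] at h
    exact (Submodule.mem_span_range_iff_exists_fun F).1 h
  choose A hA using h1
  set M : Matrix n.Partition n.Partition F := .of fun kap mu => (b kap.parts)⁻¹ * A kap mu with hM
  have hP : ∀ lam : n.Partition, hallP lam.parts = ∑ nu, M lam nu • psumPart nu.parts := by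
    intro lam
    rw [hallP]
    change _ • hallQ (rows lam.parts) = _
    rw [← evalPsum_qHat, ← hA, map_sum, Finset.smul_sum]
    simp only [map_smul, evalPsum_pMon, smul_smul, hM, Matrix.of_apply]
  -- M expresses the P_λ in the p_ν, so by linear independence X is a solution exactly when its
  -- transpose is a left inverse of M. Duality makes the transposed `green` matrix a right inverse,
  -- which suffices for square matrices.
  have hX : ∀ X : n.Partition → n.Partition → F,
      IsGreen n X ↔ (Matrix.of X).transpose * M = 1 := by
    intro X
    have h2 : ∀ mu, (psumPart mu.parts = ∑ lam, X lam mu • hallP lam.parts) ↔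
        ∀ nu, ((Matrix.of X).transpose * M) mu nu = (1 : Matrix _ _ F) mu nu := by
      intro mu
      have h3 : ∑ lam, X lam mu • hallP lam.parts =
          ∑ nu, ((Matrix.of X).transpose * M) mu nu • psumPart nu.parts := by
        simp only [hP, Finset.smul_sum, Matrix.mul_apply, Finset.sum_smul, smul_smul]
        rw [Finset.sum_comm]
        rfl
      have h4 : psumPart mu.parts = ∑ nu : n.Partition,
          (1 : Matrix _ _ F) mu nu • psumPart nu.parts := by
        simp [Matrix.one_apply]
      rw [h3]
      constructor
      · intro h
        rw [h4] at h
        have h5 := linearIndependent_psumPart n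
        rw [Fintype.linearIndependent_iff] at h5
        intro nu
        rw [eq_comm, ← sub_eq_zero]
        refine h5 (fun nu => (1 : Matrix _ _ F) mu nu - ((Matrix.of X).transpose * M) mu nu) ?_ nu
        simp only [sub_smul, Finset.sum_sub_distrib]
        rw [h, sub_self]
      · intro h
        rw [h4]
        exact Finset.sum_congr rfl fun nu _ => by rw [h]
    rw [IsGreen, ← Matrix.ext_iff]
    exact forall_congr' h2
  have hG : M * (Matrix.of fun lam mu : n.Partition =>
      green (rows lam.parts) (pMon mu.parts)).transpose = 1 := by
    ext kap lam
    have h2 := green_qHat (rows_pairwise lam.parts) (rows_pairwise kap.parts)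
      (fun a ha => lam.parts_pos (by rwa [← coe_rows lam.parts]))
      (fun a ha => kap.parts_pos (by rwa [← coe_rows kap.parts]))
    rw [← hA, map_sum, coe_rows] at h2
    simp only [map_smul, smul_eq_mul] at h2
    simp only [Matrix.mul_apply, hM, Matrix.transpose_apply, Matrix.of_apply, mul_assoc]
    rw [← Finset.mul_sum, h2, Matrix.one_apply]
    by_cases h : kap = lam
    · simp [h, b_ne_zero]
    · rw [if_neg h, if_neg, mul_zero]
      intro h'
      exact h (Nat.Partition.ext (rows_injective h'.symm))
  refine ⟨(hX _).2 (mul_eq_one_comm.1 hG), fun X h => ?_⟩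
  have h2 := (hX X).1 h
  have h3 := left_inv_eq_right_inv h2 hG
  ext lam mu
  exact congrFun (congrFun h3 mu) lam

/-! ### Evaluation of the functionals on p_μ. -/

theorem pMon_add (ρ σ : Multiset ℕ) : pMon (ρ + σ) = pMon ρ * pMon σ := by
  simp [pMon]

theorem bracket_add (ρ σ : Multiset ℕ) : bracket (ρ + σ) = bracket ρ * bracket σ := by
  simp [bracket]

theorem bracket_ne_zero {ρ : Multiset ℕ} (hρ : ∀ i ∈ ρ, 0 < i) : bracket ρ ≠ 0 := by
  refine Multiset.prod_ne_zero fun h => ?_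
  obtain ⟨i, hi, h0⟩ := Multiset.mem_map.1 h
  refine one_sub_t_pow_ne_zero (hρ i hi) ?_
  rw [← neg_sub, h0, neg_zero]

theorem prod_map_eWeight (ρ : Multiset ℕ) :
    (ρ.map eWeight).prod = (-1) ^ ρ.card * (ρ.map qWeight).prod := by
  induction ρ using Multiset.induction_on with
  | empty => simp
  | cons k ρ ih =>
    rw [Multiset.map_cons, Multiset.prod_cons, ih, Multiset.map_cons, Multiset.prod_cons,
      Multiset.card_cons, eWeight, qWeight]
    ring

theorem prod_map_eWeight_eq_bracket (ρ : Multiset ℕ) : (ρ.map eWeight).prod = bracket ρ := by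
  rw [bracket]
  congr 2
  ext1 n
  rw [eWeight, neg_sub]

/-- In this form the weight of ρ cancels against a denominator [τ ∪ ρ], which makes the sums for
hooks collapse. -/
theorem neg_one_pow_div_zt (ρ : Multiset ℕ) : (-1) ^ ρ.card / zt ρ = bracket ρ / (z ρ : F) := by
  rw [← prod_map_eWeight_eq_bracket, prod_map_eWeight, div_eq_mul_inv, inv_zt]
  ring

theorem subSum_eq (μ : Multiset ℕ) (P : Multiset ℕ → Prop) [DecidablePred P]
    (f : Multiset ℕ → F) :
    subSum μ P f = (μ.powerset.map fun τ => if P τ then f τ else 0).sum := by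
  rw [subSum]
  induction μ.powerset using Multiset.induction_on with
  | empty => rfl
  | cons τ s ih => by_cases h : P τ <;> simp [h, ih]

theorem subSum_congr {μ : Multiset ℕ} {P Q : Multiset ℕ → Prop} [DecidablePred P]
    [DecidablePred Q] {f g : Multiset ℕ → F} (hPQ : ∀ τ ≤ μ, P τ ↔ Q τ)
    (hfg : ∀ τ ≤ μ, P τ → f τ = g τ) : subSum μ P f = subSum μ Q g := by
  rw [subSum_eq, subSum_eq]
  congr 1
  refine Multiset.map_congr rfl fun τ hτ => ?_
  rw [Multiset.mem_powerset] at hτ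
  by_cases h : P τ
  · rw [if_pos h, if_pos ((hPQ τ hτ).1 h), hfg τ hτ h]
  · rw [if_neg h, if_neg fun h' => h ((hPQ τ hτ).2 h')]

theorem mul_subSum (c : F) (μ : Multiset ℕ) (P : Multiset ℕ → Prop) [DecidablePred P]
    (f : Multiset ℕ → F) : c * subSum μ P f = subSum μ P fun τ => c * f τ := by
  rw [subSum, subSum, Multiset.sum_map_mul_left]

/-- Passing to the complementary index set is a bijection on subpartitions. -/
theorem subSum_compl {μ : Multiset ℕ} {P Q : Multiset ℕ → Prop} [DecidablePred P]
    [DecidablePred Q] {f g : Multiset ℕ → F} (hPQ : ∀ σ τ, σ + τ = μ → (P σ ↔ Q τ))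
    (hfg : ∀ σ τ, σ + τ = μ → P σ → f σ = g τ) : subSum μ P f = subSum μ Q g := by
  rw [subSum_eq, subSum_eq]
  conv_lhs => rw [← Multiset.antidiagonal_map_fst, Multiset.map_map]
  conv_rhs => rw [← Multiset.antidiagonal_map_snd, Multiset.map_map]
  congr 1
  refine Multiset.map_congr rfl fun p hp => ?_
  rw [Multiset.mem_antidiagonal] at hp
  simp only [Function.comp_apply]
  by_cases h : P p.1
  · rw [if_pos h, if_pos ((hPQ _ _ hp).1 h), hfg _ _ hp h]
  · rw [if_neg h, if_neg fun h' => h ((hPQ _ _ hp).2 h')]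

theorem pos_of_le {μ τ : Multiset ℕ} (hμ : ∀ i ∈ μ, 0 < i) (h : τ ≤ μ) : ∀ i ∈ τ, 0 < i :=
  fun i hi => hμ i (Multiset.mem_of_le h hi)

theorem pos_add {σ τ : Multiset ℕ} (hσ : ∀ i ∈ σ, 0 < i) (hτ : ∀ i ∈ τ, 0 < i) :
    ∀ i ∈ σ + τ, 0 < i := fun i hi => (Multiset.mem_add.1 hi).elim (hσ i) (hτ i)

theorem eq_zero_of_sum_eq_zero {μ : Multiset ℕ} (hμ : ∀ i ∈ μ, 0 < i) (h : μ.sum = 0) :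
    μ = 0 := by
  refine Multiset.eq_zero_of_forall_notMem fun i hi => ?_
  have := Multiset.le_sum_of_mem hi
  have := hμ i hi
  omega

theorem subSum_sum_le_zero {μ : Multiset ℕ} (hμ : ∀ i ∈ μ, 0 < i) (f : Multiset ℕ → F) :
    subSum μ (fun τ => τ.sum ≤ 0) f = f 0 := by
  rw [subSum_eq]
  induction μ using Multiset.induction_on with
  | empty => simp
  | cons k μ ih =>
    have hk := hμ k (Multiset.mem_cons_self k μ)
    rw [Multiset.powerset_cons, Multiset.map_add, Multiset.sum_add,
      ih fun i hi => hμ i (Multiset.mem_cons_of_mem hi), Multiset.map_map]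
    simp [hk.ne']

/-- Expanding ∏ (1 + (t^{μ_i} - 1)) = t^{|μ|} gives the sum over all τ; the empty one contributes 1.
-/
theorem subSum_bracket {μ : Multiset ℕ} (hμ : ∀ i ∈ μ, 0 < i) :
    subSum μ (fun τ => 1 ≤ τ.sum) bracket = t ^ μ.sum - 1 := by
  have h1 : (μ.powerset.map bracket).sum = t ^ μ.sum := by
    have h2 := Multiset.prod_map_add (s := μ) (f := fun _ => (1 : F)) (g := fun i => t ^ i - 1)
    rw [Multiset.antidiagonal_eq_map_powerset, Multiset.map_map] at h2
    simp only [Multiset.map_const', Multiset.prod_replicate, one_pow, one_mul,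
      Function.comp_def, add_sub_cancel] at h2
    change _ = (μ.powerset.map bracket).sum at h2
    rw [← h2]
    clear h2 hμ
    induction μ using Multiset.induction_on with
    | empty => simp
    | cons k μ ih => simp [ih, pow_add]
  have h3 : subSum μ (fun τ => 1 ≤ τ.sum) bracket + subSum μ (fun τ => τ.sum ≤ 0) bracket =
      (μ.powerset.map bracket).sum := by
    rw [subSum_eq, subSum_eq, ← Multiset.sum_map_add]
    congr 1
    refine Multiset.map_congr rfl fun τ _ => ?_
    by_cases h : 1 ≤ τ.sum
    · rw [if_pos h, if_neg (by omega), add_zero]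
    · rw [if_neg h, if_pos (by omega), zero_add]
  rw [subSum_sum_le_zero hμ, h1] at h3
  rw [← h3]
  simp [bracket]

theorem prod_map_pow_add_C {A : Type*} [CommRing A] (x : ℕ → A) (μ : Multiset ℕ) :
    (μ.map fun n : ℕ => (Polynomial.X ^ n + Polynomial.C (x n) : Polynomial A)).prod =
      (μ.powerset.map fun τ =>
        Polynomial.X ^ (μ - τ).sum * Polynomial.C (τ.map x).prod).sum := by
  have h : ∀ σ : Multiset ℕ, (σ.map fun n : ℕ => (Polynomial.X ^ n : Polynomial A)).prod =
      Polynomial.X ^ σ.sum := by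
    intro σ
    induction σ using Multiset.induction_on with
    | empty => simp
    | cons k σ ih => simp [ih, pow_add]
  rw [Multiset.prod_map_add, Multiset.antidiagonal_eq_map_powerset, Multiset.map_map]
  congr 1
  refine Multiset.map_congr rfl fun τ _ => ?_
  rw [Function.comp_apply, h, map_multiset_prod, Multiset.map_map]
  rfl

theorem shift_one_pMon (μ : Multiset ℕ) :
    shift 1 (pMon μ) = (μ.powerset.map fun τ =>
      Polynomial.X ^ (μ - τ).sum * Polynomial.C (pMon τ)).sum := by
  refine Eq.trans ?_ (prod_map_pow_add_C MvPolynomial.X μ)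
  rw [pMon, map_multiset_prod, Multiset.map_map]
  congr 2
  ext1 n
  rw [Function.comp_apply, shift, MvPolynomial.aeval_X, one_smul, add_comm]

/-- In ∏ (p_n + y^{-n}), τ collects the factors where p_n is chosen; the others give the power of y
that fixes the index of e. -/
theorem delRow_pMon (k : ℤ) (μ : Multiset ℕ) :
    delRow k (pMon μ) = (μ.powerset.map fun τ =>
      hz eWeight ((μ - τ).sum - k) * pMon τ).sum := by
  rw [delRow, vertex_apply, shift_one_pMon, map_multiset_sum, Multiset.map_map]
  congr 1
  refine Multiset.map_congr rfl fun τ _ => ?_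
  rw [Function.comp_apply, readOff_X_pow_mul, ← mul_one (Polynomial.C _), readOff_C_mul,
    ← Polynomial.monomial_zero_one, readOff_monomial, one_mul, mul_comm, Nat.cast_zero, add_zero,
    neg_add_eq_sub]

/-- The recursion for the Green functions given by removing the first row. -/
theorem green_cons_pMon {k K : ℕ} {μ : Multiset ℕ} (hμ : μ.sum = k + K) (L : List ℕ) :
    green (k :: L) (pMon μ) = subSum μ (fun τ => τ.sum ≤ K) fun τ =>
      ∑ ρ : (K - τ.sum).Partition, (-1) ^ ρ.parts.card / zt ρ.parts *
        green L (pMon (τ + ρ.parts)) := by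
  rw [green_cons, delRow_pMon, map_multiset_sum, Multiset.map_map, subSum_eq]
  congr 1
  refine Multiset.map_congr rfl fun τ hτ => ?_
  rw [Multiset.mem_powerset] at hτ
  have h1 : (μ - τ).sum + τ.sum = μ.sum := by
    rw [← Multiset.sum_add, Multiset.sub_add_cancel hτ]
  rw [Function.comp_apply]
  split_ifs with h
  · rw [show ((μ - τ).sum : ℤ) - k = ((K - τ.sum : ℕ) : ℤ) by omega, hz_eq_sum, sum_partsOf,
      Finset.sum_mul, map_sum]
    refine Finset.sum_congr rfl fun ρ _ => ?_
    rw [smul_mul_assoc, map_smul, smul_eq_mul, pMon_add, mul_comm (pMon τ),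
      neg_one_pow_div_zt, prod_map_eWeight_eq_bracket, div_eq_inv_mul]
  · rw [hz_of_neg _ (by omega), zero_mul, map_zero]

theorem green_singleton {k : ℕ} {μ : Multiset ℕ} (hμ : ∀ i ∈ μ, 0 < i) (h : μ.sum = k) :
    green [k] (pMon μ) = 1 := by
  rw [green_cons_pMon (K := 0) (by omega), subSum_sum_le_zero hμ]
  simp [zt, z, pMon, green, MvPolynomial.coeff_one]
  exact Finset.card_univ.trans (Fintype.card_unique (α := Nat.Partition 0))

theorem green_pair {k₁ k₂ : ℕ} {μ : Multiset ℕ} (hμ : ∀ i ∈ μ, 0 < i) (h : μ.sum = k₁ + k₂) :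
    green [k₁, k₂] (pMon μ) = subSum μ (fun τ => τ.sum ≤ k₂) fun τ =>
      ∑ ρ : (k₂ - τ.sum).Partition, (-1) ^ ρ.parts.card / zt ρ.parts := by
  rw [green_cons_pMon h]
  refine subSum_congr (fun _ _ => Iff.rfl) fun τ hτ hk => Finset.sum_congr rfl fun ρ _ => ?_
  rw [green_singleton (pos_add (pos_of_le hμ hτ) fun _ hi => ρ.parts_pos hi), mul_one]
  rw [Multiset.sum_add, ρ.parts_sum]
  omega

theorem green_triple {k₁ k₂ k₃ : ℕ} {μ : Multiset ℕ} (hμ : ∀ i ∈ μ, 0 < i)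
    (h : μ.sum = k₁ + (k₂ + k₃)) :
    green [k₁, k₂, k₃] (pMon μ) = subSum μ (fun τ => τ.sum ≤ k₂ + k₃) fun τ =>
      ∑ ρ : (k₂ + k₃ - τ.sum).Partition,
        subSum (τ + ρ.parts) (fun ν => ν.sum ≤ k₃) fun ν =>
          ∑ ξ : (k₃ - ν.sum).Partition,
            (-1) ^ (ξ.parts.card + ρ.parts.card) / (zt ξ.parts * zt ρ.parts) := by
  rw [green_cons_pMon h]
  refine subSum_congr (fun _ _ => Iff.rfl) fun τ hτ hk => Finset.sum_congr rfl fun ρ _ => ?_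
  rw [green_pair (pos_add (pos_of_le hμ hτ) fun _ hi => ρ.parts_pos hi), mul_subSum]
  · simp only [Finset.mul_sum]
    refine subSum_congr (fun _ _ => Iff.rfl) fun ν _ _ => Finset.sum_congr rfl fun ξ _ => ?_
    rw [div_mul_div_comm, pow_add, mul_comm, mul_comm (zt ξ.parts)]
  · rw [Multiset.sum_add, ρ.parts_sum]
    omega

theorem sum_inv_z (a : ℕ) : ∑ ρ : a.Partition, (z ρ.parts : F)⁻¹ = 1 := by
  have h := hsum_one (R := F) a
  rw [hsum, sum_partsOf] at h
  simpa using h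

/-- In the recursion [ρ] cancels, the sum over ρ is Σ 1/z_ρ = 1, and 1/[σ] = [τ]/[μ] for the
complement τ. The column formula is a hypothesis because it is itself proved from this lemma with k
= 1. -/
theorem green_hook_of_green_column {k m : ℕ} {μ : Multiset ℕ} (hμ : ∀ i ∈ μ, 0 < i)
    (h : μ.sum = k + m) (hcol : ∀ σ : Multiset ℕ, (∀ i ∈ σ, 0 < i) → σ.sum = m →
      green (List.replicate m 1) (pMon σ) = tfact m / bracket σ) :
    green (k :: List.replicate m 1) (pMon μ) =
      tfact m / bracket μ * subSum μ (fun τ => k ≤ τ.sum) bracket := by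
  rw [green_cons_pMon h, mul_subSum]
  refine subSum_compl (fun σ τ hστ => ?_) fun σ τ hστ hσ => ?_
  · have := congrArg Multiset.sum hστ
    rw [Multiset.sum_add] at this
    omega
  · subst hστ
    have hσ0 := pos_of_le hμ (Multiset.le_add_right σ τ)
    have hτ0 := pos_of_le hμ (Multiset.le_add_left τ σ)
    have h1 : ∀ ρ : (m - σ.sum).Partition, (-1) ^ ρ.parts.card / zt ρ.parts *
        green (List.replicate m 1) (pMon (σ + ρ.parts)) =
        tfact m / bracket σ * (z ρ.parts : F)⁻¹ := by
      intro ρ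
      have hρ := bracket_ne_zero fun _ hi => ρ.parts_pos hi
      rw [hcol _ (pos_add hσ0 fun _ hi => ρ.parts_pos hi), neg_one_pow_div_zt, bracket_add]
      · field_simp
      · rw [Multiset.sum_add, ρ.parts_sum]
        omega
    simp only [h1]
    rw [← Finset.mul_sum, sum_inv_z, mul_one, bracket_add]
    have := bracket_ne_zero hτ0
    field_simp

theorem green_column (m : ℕ) {μ : Multiset ℕ} (hμ : ∀ i ∈ μ, 0 < i) (h : μ.sum = m) :
    green (List.replicate m 1) (pMon μ) = tfact m / bracket μ := by
  induction m generalizing μ with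
  | zero =>
    rw [eq_zero_of_sum_eq_zero hμ h]
    simp [green, pMon, tfact, bracket, MvPolynomial.coeff_one]
  | succ m ih =>
    rw [List.replicate_succ, green_hook_of_green_column hμ (by omega) fun σ => ih,
      subSum_bracket hμ, h, tfact, tfact, Finset.prod_Icc_succ_top (by omega)]
    ring

theorem green_hook {k m : ℕ} {μ : Multiset ℕ} (hμ : ∀ i ∈ μ, 0 < i) (h : μ.sum = k + m) :
    green (k :: List.replicate m 1) (pMon μ) =
      tfact m / bracket μ * subSum μ (fun τ => k ≤ τ.sum) bracket :=
  green_hook_of_green_column hμ h fun _ => green_column m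

theorem green_double_hook {h₁ h₂ r : ℕ} {μ : Multiset ℕ} (hμ : ∀ i ∈ μ, 0 < i)
    (h : μ.sum = h₁ + (h₂ + r)) :
    green (h₁ :: h₂ :: List.replicate r 1) (pMon μ) =
      subSum μ (fun τ => τ.sum ≤ h₂ + r) fun τ =>
        ∑ ρ : (h₂ + r - τ.sum).Partition,
          subSum (τ + ρ.parts) (fun ν => h₂ ≤ ν.sum ∧ ν.sum ≤ h₂ + r) fun ν =>
            tfact r * bracket ν / (bracket τ * (z ρ.parts : F)) := by
  rw [green_cons_pMon h]
  refine subSum_congr (fun _ _ => Iff.rfl) fun τ hτ hk => Finset.sum_congr rfl fun ρ _ => ?_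
  have hs : (τ + ρ.parts).sum = h₂ + r := by
    rw [Multiset.sum_add, ρ.parts_sum]
    omega
  have hρ := bracket_ne_zero fun _ hi => ρ.parts_pos hi
  rw [green_hook (pos_add (pos_of_le hμ hτ) fun _ hi => ρ.parts_pos hi) hs, ← mul_assoc,
    mul_subSum]
  -- The upper bound on |ν| is automatic, as ν is a subpartition of τ ∪ ρ, whose weight is h₂ + r.
  refine subSum_congr (fun ν hν => ?_) fun ν _ _ => ?_
  · obtain ⟨σ, hσ⟩ := Multiset.le_iff_exists_add.1 hν
    have := congrArg Multiset.sum hσ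
    rw [Multiset.sum_add ν] at this
    omega
  · rw [neg_one_pow_div_zt, bracket_add]
    field_simp

/-- Needed for shapes such as (n, 0): once all weight is used up, removing an empty row acts
trivially. -/
theorem green_append_zero (L : List ℕ) {μ : Multiset ℕ} (hμ : ∀ i ∈ μ, 0 < i)
    (h : μ.sum = L.sum) : green (L ++ [0]) (pMon μ) = green L (pMon μ) := by
  induction L generalizing μ with
  | nil =>
    rw [List.nil_append, green_singleton (k := 0) hμ h, eq_zero_of_sum_eq_zero hμ h]
    simp [green, pMon, MvPolynomial.coeff_one]
  | cons k L ih =>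
    rw [List.sum_cons] at h
    rw [List.cons_append, green_cons_pMon h, green_cons_pMon h]
    refine subSum_congr (fun _ _ => Iff.rfl) fun τ hτ hk => Finset.sum_congr rfl fun ρ _ => ?_
    rw [ih (pos_add (pos_of_le hμ hτ) fun _ hi => ρ.parts_pos hi)]
    rw [Multiset.sum_add, ρ.parts_sum]
    omega

theorem green_rows_filter {L : List ℕ} (hL : L.Pairwise (· ≥ ·)) {μ : Multiset ℕ}
    (hμ : ∀ i ∈ μ, 0 < i) (h : μ.sum = L.sum) :
    green (rows ((L : Multiset ℕ).filter (· ≠ 0))) (pMon μ) = green L (pMon μ) := by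
  induction L using List.reverseRecOn with
  | nil => rw [rows_eq (L := []) (by simp) List.Pairwise.nil]
  | append_singleton L a ih =>
    have hL' := List.pairwise_append.1 hL
    by_cases ha : a = 0
    · subst ha
      have h' : μ.sum = L.sum := by simpa using h
      rw [green_append_zero L hμ h', ← ih hL'.1 h', ← Multiset.coe_add,
        Multiset.filter_add]
      simp
    · rw [rows_eq (L := L ++ [a]) _ hL]
      rw [eq_comm, Multiset.filter_eq_self]
      intro i hi
      rcases List.mem_append.1 hi with hi | hi
      · have := hL'.2.2 i hi a (List.mem_singleton_self a)
        omega
      · rw [List.mem_singleton.1 hi]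
        exact ha

end HallLittlewood

end

/-! ### The theorem. -/

theorem theoremt (n : ℕ) :
    (∃! X : n.Partition → n.Partition → F, IsGreen n X) ∧
    ∀ X : n.Partition → n.Partition → F, IsGreen n X → ∀ mu : n.Partition,
      -- two-row shapes `(n - k, k)`
      (∀ (k : ℕ) (hk : k ≤ n - k),
        X (.ofSums n {n - k, k} (by simp; omega)) mu =
          subSum mu.parts (fun τ => τ.sum ≤ k) fun τ =>
            ∑ ρ : (k - τ.sum).Partition, (-1) ^ ρ.parts.card / zt ρ.parts) ∧
      -- hooks `(k, 1 ^ (n - k))`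
      (∀ (k : ℕ) (_ : 1 ≤ k) (hk : k ≤ n),
        X (.ofSums n (k ::ₘ Multiset.replicate (n - k) 1) (by simp; omega)) mu =
          tfact (n - k) / bracket mu.parts *
            subSum mu.parts (fun τ => k ≤ τ.sum) fun τ => bracket τ) ∧
      -- three-row shapes `(k₁, k₂, k₃)`
      (∀ (k₁ k₂ k₃ : ℕ) (_ : k₂ ≤ k₁) (_ : k₃ ≤ k₂) (hk : k₁ + k₂ + k₃ = n),
        X (.ofSums n {k₁, k₂, k₃} (by simp; omega)) mu =
          subSum mu.parts (fun τ => τ.sum ≤ k₂ + k₃) fun τ =>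
            ∑ ρ : (k₂ + k₃ - τ.sum).Partition,
              subSum (τ + ρ.parts) (fun ν => ν.sum ≤ k₃) fun ν =>
                ∑ ξ : (k₃ - ν.sum).Partition,
                  (-1) ^ (ξ.parts.card + ρ.parts.card) / (zt ξ.parts * zt ρ.parts)) ∧
      -- generalized hooks `(h₁, h₂, 1 ^ (n - h₁ - h₂))`
      (∀ (h₁ h₂ : ℕ) (_ : 1 ≤ h₂) (_ : h₂ ≤ h₁) (hh : h₁ + h₂ ≤ n),
        X (.ofSums n (h₁ ::ₘ h₂ ::ₘ Multiset.replicate (n - h₁ - h₂) 1) (by simp; omega)) mu =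
          subSum mu.parts (fun τ => τ.sum ≤ n - h₁) fun τ =>
            ∑ ρ : (n - h₁ - τ.sum).Partition,
              subSum (τ + ρ.parts) (fun ν => h₂ ≤ ν.sum ∧ ν.sum ≤ n - h₁) fun ν =>
                tfact (n - h₁ - h₂) * bracket ν / (bracket τ * (z ρ.parts : F))) := by
  refine ⟨⟨_, (isGreen_green_and_unique n).1, (isGreen_green_and_unique n).2⟩, fun X hX mu => ?_⟩
  rw [(isGreen_green_and_unique n).2 X hX]
  have hμ : ∀ i ∈ mu.parts, 0 < i := fun _ hi => mu.parts_pos hi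
  have hs := mu.parts_sum
  have hrep : ∀ m : ℕ, (List.replicate m 1).Pairwise (· ≥ ·) := fun m =>
    List.pairwise_replicate.2 (Or.inr le_rfl)
  refine ⟨fun k hk => ?_, fun k hk1 hk => ?_, fun k₁ k₂ k₃ h21 h32 hk => ?_,
    fun h₁ h₂ h2 h21 hh => ?_⟩
  -- `ofSums` discards zero parts, so the explicit row list is compared with the partition through
  -- `green_rows_filter`.
  · refine (green_rows_filter (L := [n - k, k]) (by simpa using hk) hμ ?_).trans
      (green_pair hμ (by omega))
    simp
    omega
  · refine (green_rows_filter (L := k :: List.replicate (n - k) 1) ?_ hμ ?_).trans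
      (green_hook hμ (by omega))
    · refine List.pairwise_cons.2 ⟨fun a ha => ?_, hrep _⟩
      rw [List.eq_of_mem_replicate ha]
      exact hk1
    · simp
      omega
  · refine (green_rows_filter (L := [k₁, k₂, k₃]) ?_ hμ ?_).trans (green_triple hμ (by omega))
    · simp
      omega
    · simp
      omega
  · refine (green_rows_filter (L := h₁ :: h₂ :: List.replicate (n - h₁ - h₂) 1) ?_ hμ ?_).trans
      ((green_double_hook hμ (by omega)).trans ?_)
    · refine List.pairwise_cons.2 ⟨fun a ha => ?_, List.pairwise_cons.2 ⟨fun a ha => ?_, hrep _⟩⟩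
      · rcases List.mem_cons.1 ha with rfl | ha
        · exact h21
        · rw [List.eq_of_mem_replicate ha]
          omega
      · rw [List.eq_of_mem_replicate ha]
        exact h2
    · simp
      omega
    · rw [show h₂ + (n - h₁ - h₂) = n - h₁ by omega]
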